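/- Let $\gamma$ be the standard Gaussian measure on $\mathbb{R}^n$, with density $(2\pi)^{-n/2}e^{-|x|^2/2}$, and let $\cosh_2(x)=\cosh x-1$. For $k\in\{1,2\}$ let $L^{(\cosh_2,k)}(\gamma)$ be the Orlicz space of (classes of $\gamma$-a.e. equal) real measurable functions $f$ on $\mathbb{R}^n$ for which there is $\rho>0$ with $\int \cosh_2\big(|\rho^{-1}f|^k\big)\,d\gamma\le 1$. A locally integrable function $g$ is the weak partial derivative $\partial_i f$ of a locally integrable function $f$ if $$\int g\,\phi\,d\gamma=\int f\,\delta_i\phi\,d\gamma ,\qquad \delta_i\phi(x)=x_i\phi(x)-\frac{\partial\phi}{\partial x_i}(x),$$ for all $\phi\in C^1(\mathbb{R}^n)$ with compact support. Define the Gaussian Orlicz–Sobolev space $$W^1L^{(\cosh_2,(1,2))}(\gamma)=\{f\in L^{(\cosh_2,1)}(\gamma) : \partial_i f \text{ exists and } \partial_i f\in L^{(\cosh_2,2)}(\gamma),\ i=1,\dots,n\}.$$ Then: 1. $W^1L^{(\cosh_2,(1,2))}(\gamma)$ contains the constants and all real polynomials in $x_1,\dots,x_n$ of total degree at most $2$.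 2. Each $f\in W^1L^{(\cosh_2,(1,2))}(\gamma)$ has a continuous version, that is, there is a continuous function on $\mathbb{R}^n$ that is equal to $f$ $\gamma$-almost everywhere. 3. If $G:\mathbb{R}\to\mathbb{R}$ is a primitive of a bounded (measurable) function $g$, that is, $G(b)-G(a)=\int_a^b g(t)\,dt$ for all $a,b\in\mathbb{R}$, then $G\circ f\in W^1L^{(\cosh_2,(1,2))}(\gamma)$ for every $f\in W^1L^{(\cosh_2,(1,2))}(\gamma)$. 4. If $f,g\in W^1L^{(\cosh_2,(1,2))}(\gamma)$, then $\min(f,g)$ and $\max(f,g)$ belong to $W^1L^{(\cosh_2,(1,2))}(\gamma)$. -/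

import Mathlib

open MeasureTheory ProbabilityTheory
open scoped ENNReal

namespace GaussianOrlicz

noncomputable section

/-- The standard Gaussian measure `γ(x) dx` of `ℝⁿ`. -/
abbrev gaussian (n : ℕ) : Measure (EuclideanSpace ℝ (Fin n)) :=
  stdGaussian (EuclideanSpace ℝ (Fin n))

/-- The standard Gaussian measure has density `γ(x) = (2π)^{-n/2} exp (-|x|²/2)`. -/
theorem gaussian_eq_withDensity (n : ℕ) :
    gaussian n = (volume : Measure (EuclideanSpace ℝ (Fin n))).withDensity
      (fun x => ENNReal.ofReal ((√(2 * Real.pi))⁻¹ ^ n * Real.exp (-‖x‖ ^ 2 / 2))) := by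
  have key : Measure.pi (fun _ : Fin n => gaussianReal 0 1) =
      (volume : Measure (Fin n → ℝ)).withDensity
        (fun x => ENNReal.ofReal (∏ i, gaussianPDFReal 0 1 (x i))) := by
    refine Measure.pi_eq (fun s hs => ?_)
    rw [withDensity_apply _ (MeasurableSet.univ_pi hs), volume_pi, Measure.restrict_pi_pi,
      ← ofReal_integral_eq_lintegral_ofReal, integral_fintype_prod_eq_prod,
      ENNReal.ofReal_prod_of_nonneg]
    · refine Finset.prod_congr rfl (fun i _ => ?_)
      rw [gaussianReal_apply_eq_integral 0 one_ne_zero]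
    · exact fun i _ => integral_nonneg (fun x => gaussianPDFReal_nonneg 0 1 x)
    · exact Integrable.fintype_prod (fun i => (integrable_gaussianPDFReal 0 1).integrableOn)
    · exact Filter.Eventually.of_forall
        (fun x => Finset.prod_nonneg (fun i _ => gaussianPDFReal_nonneg 0 1 (x i)))
  rw [gaussian, ← map_pi_eq_stdGaussian, key]
  ext s hs
  rw [Measure.map_apply (by fun_prop) hs,
    withDensity_apply _ (hs.preimage (by fun_prop)), withDensity_apply _ hs,
    ← (PiLp.volume_preserving_toLp (Fin n)).setLIntegral_comp_preimage hs (by fun_prop)]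
  refine lintegral_congr (fun x => ?_)
  congr 1
  simp only [gaussianPDFReal, Finset.prod_mul_distrib, Finset.prod_const, ← Real.exp_sum,
    EuclideanSpace.norm_sq_eq]
  simp [Finset.sum_div, neg_div]

/-- The Young function `cosh₂ x = cosh x - 1`. -/
def cosh₂ (x : ℝ) : ℝ := Real.cosh x - 1

/-- `f` belongs to the Orlicz space `L^Φ(μ)`, the space whose closed unit ball is the set of the
`f ∈ L⁰(μ)` with `∫ Φ(|f|) dμ ≤ 1`: some positive multiple of `f` is in that ball. -/
def MemOrlicz {α : Type*} [MeasurableSpace α] (Φ : ℝ → ℝ) (μ : Measure α) (f : α → ℝ) : Prop :=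
  AEStronglyMeasurable f μ ∧
    ∃ ρ : ℝ, 0 < ρ ∧ ∫⁻ x, ENNReal.ofReal (Φ (ρ⁻¹ * |f x|)) ∂μ ≤ 1

/-- `f` belongs to `L^{(Φ, k)}(μ)`, the Orlicz space of the Young function `x ↦ Φ (|x| ^ k)`. -/
def MemOrliczPow {α : Type*} [MeasurableSpace α] (Φ : ℝ → ℝ) (k : ℕ) (μ : Measure α)
    (f : α → ℝ) : Prop :=
  MemOrlicz (fun x => Φ (|x| ^ k)) μ f

/-- The classical partial derivative `∂ᵢ φ`. -/
def partialDeriv {n : ℕ} (i : Fin n) (φ : EuclideanSpace ℝ (Fin n) → ℝ)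
    (x : EuclideanSpace ℝ (Fin n)) : ℝ :=
  fderiv ℝ φ x (EuclideanSpace.single i 1)

/-- The Gaussian divergence `δᵢ φ (x) = xᵢ φ(x) - ∂ᵢ φ(x)`. -/
def gaussDiv {n : ℕ} (i : Fin n) (φ : EuclideanSpace ℝ (Fin n) → ℝ)
    (x : EuclideanSpace ℝ (Fin n)) : ℝ :=
  x i * φ x - partialDeriv i φ x

/-- `g` is the weak partial derivative `∂ᵢ f`: `f` and `g` are locally integrable and
`⟨g, φ⟩_γ = ⟨f, δᵢ φ⟩_γ` for all continuously differentiable `φ` with compact support. -/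
def IsWeakPartialDeriv {n : ℕ} (i : Fin n) (f g : EuclideanSpace ℝ (Fin n) → ℝ) : Prop :=
  LocallyIntegrable f (gaussian n) ∧ LocallyIntegrable g (gaussian n) ∧
    ∀ φ : EuclideanSpace ℝ (Fin n) → ℝ, ContDiff ℝ 1 φ → HasCompactSupport φ →
      ∫ x, g x * φ x ∂(gaussian n) = ∫ x, f x * gaussDiv i φ x ∂(gaussian n)

/-- The Gaussian Orlicz–Sobolev space `W¹ L^{(cosh₂, (1,2))}(γ)`. Its elements are represented by
functions; the conditions depend only on the `γ`-almost everywhere class. -/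
def orliczSobolev (n : ℕ) : Set (EuclideanSpace ℝ (Fin n) → ℝ) :=
  {f | MemOrliczPow cosh₂ 1 (gaussian n) f ∧
    ∀ i : Fin n, ∃ g : EuclideanSpace ℝ (Fin n) → ℝ,
      IsWeakPartialDeriv i f g ∧ MemOrliczPow cosh₂ 2 (gaussian n) g}

/-- `G` is a primitive of the locally integrable function `g : ℝ → ℝ`. -/
def IsPrimitive (G g : ℝ → ℝ) : Prop :=
  LocallyIntegrable g ∧ ∀ a b : ℝ, G b - G a = ∫ t in a..b, g t

end

end GaussianOrlicz

/-! The Gaussian density is smooth and positive, so multiplying test functions by it turns the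
Gaussian weak derivative into the ordinary one (`isWeakPartialDeriv_iff`). Membership in either
Orlicz space means that exp(c|f|^k) is γ-integrable for some c > 0 (`memOrliczPow_cosh₂_iff`). It is
therefore a matter of growth only, and it gives moments of every order.

Regularity rests on the fundamental theorem of calculus along lines: f(x + te) − f(x) = ∫₀ᵗ ∂ₑf(x +
se) ds for almost every x (`HasWeakDeriv.ae_sub_eq_intervalIntegral`).

The claims on G ∘ f, min and max are instances of one: Φ(f, g) stays in the space when Φ is
Lipschitz. No chain rule is needed. By the formula above, increments of Φ(f, g) along e are at most
line integrals of D = K|∂f| + K|∂g|, so the distributional derivative is dominated by D. Since D ∈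
L²(γ), the Riesz theorem represents that derivative by a function u with |u| ≤ D, and u inherits the
exponential integrability of D.

Continuity is Morrey's embedding with exponent 2n + 1. Averages of f at scale r are continuous;
almost everywhere on a fixed ball they differ from f by at most ∫₀ʳ J, with J integrable near 0, so
they converge locally uniformly. For polynomials the density absorbs exp(c(1 + |x|)²) for small c,
and the classical derivatives have degree at most 1. -/

namespace GaussianOrlicz

open Filter Set
open scoped Topology Convolution

/-! ### Weak derivatives along a direction and increments along lines -/

section WeakDerivative

variable {E : Type*} [NormedAddCommGroup E] [InnerProductSpace ℝ E] [FiniteDimensional ℝ E]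
  [MeasurableSpace E] [BorelSpace E]

/-- `g` is the weak derivative of `f` in the direction `e`, with respect to Lebesgue measure. -/
def HasWeakDeriv (e : E) (f g : E → ℝ) : Prop :=
  LocallyIntegrable f ∧ LocallyIntegrable g ∧
    ∀ ψ : E → ℝ, ContDiff ℝ 1 ψ → HasCompactSupport ψ →
      ∫ x, g x * ψ x = -∫ x, f x * fderiv ℝ ψ x e

omit [InnerProductSpace ℝ E] [FiniteDimensional ℝ E] [MeasurableSpace E] [BorelSpace E] in
theorem HasCompactSupport.comp_sub_right {ψ : E → ℝ} (hc : HasCompactSupport ψ) (z : E) :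
    HasCompactSupport (fun y => ψ (y - z)) :=
  hc.comp_homeomorph (Homeomorph.subRight z)

theorem integrable_mul_comp_sub {f ψ : E → ℝ} (hf : LocallyIntegrable f) (hψ : Continuous ψ)
    (hc : HasCompactSupport ψ) (z : E) : Integrable (fun y => f y * ψ (y - z)) :=
  hf.integrable_smul_right_of_hasCompactSupport (g := fun y => ψ (y - z)) (by fun_prop)
    (HasCompactSupport.comp_sub_right hc z)

theorem integrable_mul_of_hasCompactSupport {f ψ : E → ℝ} (hf : LocallyIntegrable f)
    (hψ : Continuous ψ) (hc : HasCompactSupport ψ) : Integrable (fun y => f y * ψ y) :=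
  hf.integrable_smul_right_of_hasCompactSupport hψ hc

/-- Pairing with translates is convolution with the reflected test function; continuity and
differentiability in the translation are then known facts on convolutions. -/
theorem integral_mul_comp_sub_eq_convolution (f ψ : E → ℝ) :
    (fun z => ∫ y, f y * ψ (y - z)) =
      (f ⋆[ContinuousLinearMap.lsmul ℝ ℝ, volume] (fun y => ψ (-y))) := by
  ext z
  simp [convolution_def]

theorem continuous_integral_mul_comp_sub {f ψ : E → ℝ} (hf : LocallyIntegrable f)
    (hψ : Continuous ψ) (hc : HasCompactSupport ψ) :
    Continuous (fun z => ∫ y, f y * ψ (y - z)) := by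
  rw [integral_mul_comp_sub_eq_convolution]
  exact HasCompactSupport.continuous_convolution_right _
    (hc.comp_homeomorph (Homeomorph.neg E)) hf (by fun_prop)

theorem hasDerivAt_integral_mul_comp_sub {f ψ : E → ℝ} (hf : LocallyIntegrable f)
    (hψ : ContDiff ℝ 1 ψ) (hc : HasCompactSupport ψ) (e : E) (t : ℝ) :
    HasDerivAt (fun t : ℝ => ∫ y, f y * ψ (y - t • e))
      (-∫ y, f y * fderiv ℝ ψ (y - t • e) e) t := by
  have hc' : HasCompactSupport (fun y => ψ (-y)) := hc.comp_homeomorph (Homeomorph.neg E)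
  have hψ' : ContDiff ℝ 1 (fun y => ψ (-y)) := hψ.comp contDiff_neg
  have h := hc'.hasFDerivAt_convolution_right (ContinuousLinearMap.lsmul ℝ ℝ) hf hψ' (t • e)
  rw [← integral_mul_comp_sub_eq_convolution] at h
  have h2 : HasDerivAt (fun t : ℝ => t • e) e t := by
    simpa using (hasDerivAt_id t).smul_const e
  have h3 := h.comp_hasDerivAt t h2
  refine h3.congr_deriv ?_
  rw [convolution_precompR_apply _ hf (hc'.fderiv ℝ) (hψ'.continuous_fderiv one_ne_zero),
    convolution_def, ← integral_neg]
  refine integral_congr_ae (Eventually.of_forall fun y => ?_)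
  have h4 : HasFDerivAt (fun y => ψ (-y)) ((fderiv ℝ ψ (-(t • e - y))).comp
      (-ContinuousLinearMap.id ℝ E)) (t • e - y) :=
    HasFDerivAt.comp (g := ψ) _ ((hψ.differentiable one_ne_zero) _).hasFDerivAt
      (hasFDerivAt_id _).neg
  simp [h4.fderiv]

theorem integrable_prod_mul_comp_sub {D ψ : E → ℝ} (hD : LocallyIntegrable D)
    (hψ : Continuous ψ) (hc : HasCompactSupport ψ) (e : E) (t : ℝ) :
    Integrable (fun p : ℝ × E => D p.2 * ψ (p.2 - p.1 • e))
      ((volume.restrict (Ioc 0 t)).prod volume) := by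
  have hm : AEStronglyMeasurable (fun p : ℝ × E => D p.2 * ψ (p.2 - p.1 • e))
      ((volume.restrict (Ioc 0 t)).prod volume) := by
    refine (hD.aestronglyMeasurable.comp_snd).mul ?_
    exact (by fun_prop : Continuous fun p : ℝ × E => ψ (p.2 - p.1 • e)).aestronglyMeasurable
  rw [integrable_prod_iff hm]
  refine ⟨Eventually.of_forall fun s => integrable_mul_comp_sub hD hψ hc (s • e), ?_⟩
  have hDn : LocallyIntegrable (fun y => ‖D y‖) :=
    hD.mono hD.aestronglyMeasurable.norm (Eventually.of_forall fun y => (norm_norm _).le)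
  have hcont : Continuous (fun s : ℝ => ∫ y, ‖D y‖ * ‖ψ (y - s • e)‖) :=
    (continuous_integral_mul_comp_sub hDn hψ.norm hc.norm).comp
      (by fun_prop : Continuous fun s : ℝ => s • e)
  simp only [norm_mul]
  exact (hcont.integrableOn_Icc).mono_set Ioc_subset_Icc_self

/-- On each slice the shear is a translation. It moves the shift from the test function to D, so
that Fubini applies to line integrals of a merely locally integrable D. -/
theorem measurePreserving_shear (e : E) (t : ℝ) :
    MeasurePreserving (fun p : ℝ × E => (p.1, p.2 + p.1 • e))
      ((volume.restrict (Ioc 0 t)).prod volume) ((volume.restrict (Ioc 0 t)).prod volume) := by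
  refine MeasurePreserving.skew_product (g := fun s x => x + s • e) (MeasurePreserving.id _)
    (by fun_prop) (Eventually.of_forall fun s => ?_)
  exact map_add_right_eq_self _ _

theorem integrable_prod_comp_add_mul {D ψ : E → ℝ} (hD : LocallyIntegrable D)
    (hψ : Continuous ψ) (hc : HasCompactSupport ψ) (e : E) (t : ℝ) :
    Integrable (fun p : ℝ × E => D (p.2 + p.1 • e) * ψ p.2)
      ((volume.restrict (Ioc 0 t)).prod volume) := by
  have h := (measurePreserving_shear e t).integrable_comp_of_integrable
    (integrable_prod_mul_comp_sub hD hψ hc e t)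
  refine h.congr (Eventually.of_forall fun p => ?_)
  simp

theorem integral_comp_add_mul {f ψ : E → ℝ} (z : E) :
    ∫ x, f (x + z) * ψ x = ∫ y, f y * ψ (y - z) := by
  rw [← integral_add_right_eq_self (fun y => f y * ψ (y - z)) z]
  simp

theorem integrable_intervalIntegral_mul {D ψ : E → ℝ} (hD : LocallyIntegrable D)
    (hψ : Continuous ψ) (hc : HasCompactSupport ψ) (e : E) {t : ℝ} (ht : 0 ≤ t) :
    Integrable (fun x => (∫ s in (0:ℝ)..t, D (x + s • e)) * ψ x) := by
  have h := (integrable_prod_comp_add_mul hD hψ hc e t).integral_prod_right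
  refine h.congr (Eventually.of_forall fun x => ?_)
  simp only [intervalIntegral.integral_of_le ht]
  exact integral_mul_const _ _

theorem integral_intervalIntegral_mul {D ψ : E → ℝ} (hD : LocallyIntegrable D)
    (hψ : Continuous ψ) (hc : HasCompactSupport ψ) (e : E) {t : ℝ} (ht : 0 ≤ t) :
    ∫ x, (∫ s in (0:ℝ)..t, D (x + s • e)) * ψ x =
      ∫ s in (0:ℝ)..t, ∫ y, D y * ψ (y - s • e) := by
  have h := integral_integral_swap (f := fun (s : ℝ) (x : E) => D (x + s • e) * ψ x)
    (integrable_prod_comp_add_mul hD hψ hc e t)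
  rw [intervalIntegral.integral_of_le ht]
  simp only [integral_comp_add_mul] at h
  rw [h]
  refine integral_congr_ae (Eventually.of_forall fun x => ?_)
  simp only [intervalIntegral.integral_of_le ht]
  exact (integral_mul_const _ _).symm

theorem locallyIntegrable_intervalIntegral {D : E → ℝ} (hD : LocallyIntegrable D) (e : E)
    {t : ℝ} (ht : 0 ≤ t) : LocallyIntegrable (fun x => ∫ s in (0:ℝ)..t, D (x + s • e)) := by
  rw [locallyIntegrable_iff]
  intro K hK
  obtain ⟨ψ, h1, -, hc, -⟩ := exists_continuous_one_zero_of_isCompact hK isClosed_empty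
    (disjoint_empty K)
  refine ((integrable_intervalIntegral_mul hD ψ.continuous hc e ht).integrableOn (s := K)).congr_fun
    (fun x hx => ?_) hK.measurableSet
  simp [h1 hx]

theorem LocallyIntegrable.comp_add_right {f : E → ℝ} (hf : LocallyIntegrable f) (z : E) :
    LocallyIntegrable (fun x => f (x + z)) := by
  have h := locallyIntegrable_map_homeomorph (Homeomorph.addRight z) (f := f)
    (μ := (volume : Measure E))
  rw [show (Measure.map (Homeomorph.addRight z) (volume : Measure E)) = volume from
    map_add_right_eq_self _ _] at h
  exact h.1 hf

theorem integrable_comp_add_mul {f ψ : E → ℝ} (hf : LocallyIntegrable f)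
    (hψ : Continuous ψ) (hc : HasCompactSupport ψ) (z : E) :
    Integrable (fun x => f (x + z) * ψ x) :=
  integrable_mul_of_hasCompactSupport (LocallyIntegrable.comp_add_right hf z) hψ hc

/-- Both sides are tested against ψ. The pairing of f with ψ(· − se) is differentiable in s, and the
weak derivative identifies its derivative as the pairing of D with the same translate. The classical
fundamental theorem of calculus in s, then Fubini, give equal pairings. -/
theorem HasWeakDeriv.ae_sub_eq_intervalIntegral {e : E} {f D : E → ℝ} (h : HasWeakDeriv e f D)
    {t : ℝ} (ht : 0 ≤ t) :
    ∀ᵐ x, f (x + t • e) - f x = ∫ s in (0:ℝ)..t, D (x + s • e) := by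
  obtain ⟨hf, hD, hw⟩ := h
  refine ae_eq_of_integral_contDiff_smul_eq
    ((LocallyIntegrable.comp_add_right hf (t • e)).sub hf)
    (locallyIntegrable_intervalIntegral hD e ht) fun ψ hψ hc => ?_
  have hψ1 : ContDiff ℝ 1 ψ := hψ.of_le (by exact_mod_cast le_top)
  have hψc := hψ.continuous
  simp only [smul_eq_mul, mul_comm (ψ _)]
  rw [integral_intervalIntegral_mul hD hψc hc e ht]
  have hw' : ∀ s : ℝ, ∫ y, D y * ψ (y - s • e) = -∫ y, f y * fderiv ℝ ψ (y - s • e) e := by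
    intro s
    rw [hw (fun y => ψ (y - s • e)) (by fun_prop) (HasCompactSupport.comp_sub_right hc _)]
    simp only [sub_eq_add_neg, fderiv_comp_add_right]
  have hd : ∀ s : ℝ, HasDerivAt (fun t : ℝ => ∫ y, f y * ψ (y - t • e))
      (∫ y, D y * ψ (y - s • e)) s := by
    intro s
    rw [hw']
    exact hasDerivAt_integral_mul_comp_sub hf hψ1 hc e s
  have hcont : Continuous (fun s : ℝ => ∫ y, D y * ψ (y - s • e)) :=
    (continuous_integral_mul_comp_sub hD hψc hc).comp (by fun_prop : Continuous fun s : ℝ => s • e)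
  rw [intervalIntegral.integral_eq_sub_of_hasDerivAt (fun s _ => hd s)
    (hcont.intervalIntegrable _ _)]
  simp only [sub_mul]
  rw [integral_sub (integrable_comp_add_mul hf hψc hc _)
    (integrable_mul_of_hasCompactSupport hf hψc hc), integral_comp_add_mul]
  simp

/-- An `L¹` modulus of continuity along `e` bounds the distributional derivative along `e`. -/
theorem abs_integral_mul_fderiv_le {e : E} {F D : E → ℝ} (hF : LocallyIntegrable F)
    (hD : LocallyIntegrable D)
    (hFD : ∀ t : ℝ, 0 < t → ∀ᵐ x, |F (x + t • e) - F x| ≤ ∫ s in (0:ℝ)..t, D (x + s • e))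
    {ψ : E → ℝ} (hψ : ContDiff ℝ 1 ψ) (hc : HasCompactSupport ψ) :
    |∫ x, F x * fderiv ℝ ψ x e| ≤ ∫ x, D x * |ψ x| := by
  have hψc := hψ.continuous
  have hcont : Continuous (fun s : ℝ => ∫ y, D y * |ψ (y - s • e)|) :=
    (continuous_integral_mul_comp_sub hD hψc.abs hc.norm).comp
      (by fun_prop : Continuous fun s : ℝ => s • e)
  have hQ : HasDerivAt (fun t : ℝ => ∫ s in (0:ℝ)..t, ∫ y, D y * |ψ (y - s • e)|)
      (∫ x, D x * |ψ x|) 0 := by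
    simpa using (hcont.integral_hasStrictDerivAt 0 0).hasDerivAt
  have hH : HasDerivAt (fun t : ℝ => ∫ y, F y * ψ (y - t • e))
      (-∫ x, F x * fderiv ℝ ψ x e) 0 := by
    simpa using hasDerivAt_integral_mul_comp_sub hF hψ hc e 0
  have key : ∀ t : ℝ, 0 < t → |(∫ y, F y * ψ (y - t • e)) - ∫ y, F y * ψ y| ≤
      ∫ s in (0:ℝ)..t, ∫ y, D y * |ψ (y - s • e)| := by
    intro t ht
    rw [← integral_intervalIntegral_mul hD hψc.abs hc.norm e ht.le, ← integral_comp_add_mul,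
      ← integral_sub (integrable_comp_add_mul hF hψc hc _)
        (integrable_mul_of_hasCompactSupport hF hψc hc), ← Real.norm_eq_abs]
    refine norm_integral_le_of_norm_le
      (integrable_intervalIntegral_mul hD hψc.abs hc.norm e ht.le) ?_
    filter_upwards [hFD t ht] with x hx
    rw [← sub_mul, norm_mul]
    exact mul_le_mul_of_nonneg_right hx (norm_nonneg _)
  -- Both sides of `key` vanish at t = 0, so dividing by t > 0 and letting t → 0⁺ compares the two
  -- derivatives; one-sided slopes suffice.
  have hH' := (hasDerivAt_iff_tendsto_slope_zero.1 hH).mono_left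
    (nhdsWithin_mono 0 (fun t (ht : t ∈ Ioi (0:ℝ)) => ne_of_gt ht))
  have hQ' := (hasDerivAt_iff_tendsto_slope_zero.1 hQ).mono_left
    (nhdsWithin_mono 0 (fun t (ht : t ∈ Ioi (0:ℝ)) => ne_of_gt ht))
  rw [← abs_neg]
  refine le_of_tendsto_of_tendsto hH'.abs hQ' ?_
  filter_upwards [self_mem_nhdsWithin] with t (ht : 0 < t)
  simp only [zero_add, zero_smul, sub_zero, intervalIntegral.integral_same, smul_eq_mul, abs_mul,
    abs_of_pos (inv_pos.2 ht)]
  exact mul_le_mul_of_nonneg_left (key t ht) (inv_pos.2 ht).le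

end WeakDerivative

/-! ### Testing positivity, and Riesz representation on a space of test functions -/

section Riesz

variable {E : Type*} [NormedAddCommGroup E] [InnerProductSpace ℝ E] [FiniteDimensional ℝ E]
  [MeasurableSpace E] [BorelSpace E]

/-- Mollifications of q are nonnegative and converge to q almost everywhere. -/
theorem ae_nonneg_of_forall_integral_contDiff_mul_nonneg {q : E → ℝ} (hq : LocallyIntegrable q)
    (h : ∀ ψ : E → ℝ, ContDiff ℝ 1 ψ → HasCompactSupport ψ → (∀ x, 0 ≤ ψ x) →
      0 ≤ ∫ x, q x * ψ x) : ∀ᵐ x, 0 ≤ q x := by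
  -- The ratio of outer to inner radius stays at 2, as almost everywhere convergence requires it
  -- bounded.
  let φ : ℕ → ContDiffBump (0 : E) := fun k =>
    ⟨1 / ((k : ℝ) + 1), 2 * (1 / ((k : ℝ) + 1)), by positivity, by
      have : 0 < 1 / ((k : ℝ) + 1) := by positivity
      linarith⟩
  have hlim : Tendsto (fun k => (φ k).rOut) atTop (𝓝 0) := by
    have := (tendsto_one_div_add_atTop_nhds_zero_nat (𝕜 := ℝ)).const_mul 2
    rwa [mul_zero] at this
  filter_upwards [ContDiffBump.ae_convolution_tendsto_right_of_locallyIntegrable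
    (φ := φ) (K := 2) hlim (Eventually.of_forall fun k => le_rfl) hq] with x hx
  refine ge_of_tendsto' hx fun k => ?_
  have hc : HasCompactSupport (fun y => (φ k).normed volume (x - y)) :=
    (φ k).hasCompactSupport_normed.comp_homeomorph (Homeomorph.subLeft x)
  have hs : ContDiff ℝ 1 (fun y => (φ k).normed volume (x - y)) :=
    (φ k).contDiff_normed.comp (contDiff_const.sub contDiff_id)
  rw [convolution_eq_swap]
  simpa [mul_comm] using h _ hs hc fun y => (φ k).nonneg_normed _

/-- A functional on a space of square integrable functions that is bounded for the `L²` norm is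
given by a square integrable function. -/
theorem exists_memLp_two_integral_mul_eq {α : Type*} [MeasurableSpace α] {μ : Measure α}
    (V : Submodule ℝ (α → ℝ)) (hV : ∀ φ ∈ V, MemLp φ 2 μ) (T : V →ₗ[ℝ] ℝ) (C : ℝ)
    (hT : ∀ φ : V, |T φ| ≤ C * (eLpNorm φ.1 2 μ).toReal) :
    ∃ u : α → ℝ, MemLp u 2 μ ∧ ∀ φ : V, T φ = ∫ x, u x * φ.1 x ∂μ := by
  let j : V →ₗ[ℝ] Lp ℝ 2 μ :=
    { toFun := fun φ => (hV φ.1 φ.2).toLp φ.1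
      map_add' := fun _ _ => rfl
      map_smul' := fun _ _ => rfl }
  have hj : ∀ φ : V, j φ = (hV φ.1 φ.2).toLp φ.1 := fun _ => rfl
  have hb : ∃ C : ℝ, ∀ φ, ‖T φ‖ ≤ C * ‖j φ‖ := ⟨C, fun φ => by
    rw [hj, Lp.norm_toLp]
    exact hT φ⟩
  -- By the bound, T descends to a continuous functional on the image of V in L². Hahn–Banach
  -- extends it to all of L², where the Riesz theorem applies.
  obtain ⟨g, hg, -⟩ := exists_extension_norm_eq (LinearMap.range j) (T.compLeftInverse j)
  refine ⟨(InnerProductSpace.toDual ℝ (Lp ℝ 2 μ)).symm g, Lp.memLp _, fun φ => ?_⟩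
  have h1 : g (j φ) = T φ := by
    rw [← LinearMap.compLeftInverse_apply_of_bdd T j hb φ (j φ) rfl]
    exact hg ⟨j φ, LinearMap.mem_range_self j φ⟩
  rw [← h1, ← InnerProductSpace.toDual_symm_apply, L2.inner_def]
  refine integral_congr_ae ?_
  filter_upwards [(hV φ.1 φ.2).coeFn_toLp] with x hx
  rw [hj, hx]
  simp [mul_comm]

end Riesz

/-! ### From the Gaussian measure to Lebesgue measure, and dominated derivatives -/

section Gaussian

variable {n : ℕ}

/-- The density of the standard Gaussian measure. -/
noncomputable def gaussDensity (n : ℕ) (x : EuclideanSpace ℝ (Fin n)) : ℝ :=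
  (√(2 * Real.pi))⁻¹ ^ n * Real.exp (-‖x‖ ^ 2 / 2)

theorem gaussDensity_pos (x : EuclideanSpace ℝ (Fin n)) : 0 < gaussDensity n x := by
  have := Real.pi_pos
  unfold gaussDensity
  positivity

theorem contDiff_gaussDensity {m : WithTop ℕ∞} : ContDiff ℝ m (gaussDensity n) :=
  contDiff_const.mul (Real.contDiff_exp.comp ((contDiff_norm_sq ℝ).neg.div_const 2))

theorem continuous_gaussDensity : Continuous (gaussDensity n) :=
  (contDiff_gaussDensity (m := 1)).continuous

theorem gaussian_eq : gaussian n =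
    volume.withDensity (fun x => ENNReal.ofReal (gaussDensity n x)) :=
  gaussian_eq_withDensity n

theorem fderiv_gaussDensity (x e : EuclideanSpace ℝ (Fin n)) :
    fderiv ℝ (gaussDensity n) x e = -(inner ℝ x e) * gaussDensity n x := by
  have h1 : HasFDerivAt (fun x : EuclideanSpace ℝ (Fin n) => -‖x‖ ^ 2 / 2)
      ((-(2:ℝ)⁻¹) • (2 • innerSL ℝ x)) x := by
    convert! (hasStrictFDerivAt_norm_sq x).hasFDerivAt.const_mul (-(2:ℝ)⁻¹) using 1
    ext y
    ring
  have h2 := (h1.exp).const_mul ((√(2 * Real.pi))⁻¹ ^ n)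
  have h3 : HasFDerivAt (gaussDensity n) _ x := h2
  rw [h3.fderiv]
  simp [gaussDensity]
  ring

theorem ae_gaussian_iff {p : EuclideanSpace ℝ (Fin n) → Prop} :
    (∀ᵐ x ∂(gaussian n), p x) ↔ ∀ᵐ x, p x := by
  have h1 : gaussian n ≪ volume := by
    rw [gaussian_eq]
    exact withDensity_absolutelyContinuous _ _
  have h2 : volume ≪ gaussian n := by
    rw [gaussian_eq]
    refine withDensity_absolutelyContinuous'
      continuous_gaussDensity.measurable.ennreal_ofReal.aemeasurable ?_
    exact Eventually.of_forall fun x => (ENNReal.ofReal_pos.2 (gaussDensity_pos x)).ne'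
  exact ⟨fun h => h2.ae_le h, fun h => h1.ae_le h⟩

theorem integral_gaussian (f : EuclideanSpace ℝ (Fin n) → ℝ) :
    ∫ x, f x ∂(gaussian n) = ∫ x, gaussDensity n x * f x := by
  rw [gaussian_eq, integral_withDensity_eq_integral_toReal_smul
    continuous_gaussDensity.measurable.ennreal_ofReal (Eventually.of_forall fun _ => by simp)]
  simp [ENNReal.toReal_ofReal (gaussDensity_pos _).le]

/-- The density and its reciprocal are continuous, hence bounded on compact sets. -/
theorem locallyIntegrable_gaussian_iff {f : EuclideanSpace ℝ (Fin n) → ℝ} :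
    LocallyIntegrable f (gaussian n) ↔ LocallyIntegrable f := by
  simp only [locallyIntegrable_iff]
  refine forall₂_congr fun K hK => ?_
  have h1 : IntegrableOn f K (gaussian n) ↔ IntegrableOn (fun x => gaussDensity n x * f x) K := by
    rw [gaussian_eq, IntegrableOn, restrict_withDensity hK.measurableSet,
      integrable_withDensity_iff_integrable_smul'
        continuous_gaussDensity.measurable.ennreal_ofReal (Eventually.of_forall fun _ => by simp)]
    simp [ENNReal.toReal_ofReal (gaussDensity_pos _).le, IntegrableOn]
  rw [h1]
  refine ⟨fun h => ?_, fun h => h.continuousOn_mul continuous_gaussDensity.continuousOn hK⟩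
  have h2 := h.continuousOn_mul (g := fun x => (gaussDensity n x)⁻¹)
    (continuous_gaussDensity.inv₀ fun x => (gaussDensity_pos x).ne').continuousOn hK
  refine h2.congr_fun (fun x _ => ?_) hK.measurableSet
  simp [(gaussDensity_pos x).ne']

/-- The product rule with ∂ᵢγ = −xᵢγ: this is why δᵢ is the adjoint of ∂ᵢ for γ. -/
theorem gaussDensity_mul_gaussDiv (i : Fin n) {φ : EuclideanSpace ℝ (Fin n) → ℝ}
    (hφ : ContDiff ℝ 1 φ) (x : EuclideanSpace ℝ (Fin n)) :
    gaussDensity n x * gaussDiv i φ x =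
      -fderiv ℝ (fun y => φ y * gaussDensity n y) x (EuclideanSpace.single i 1) := by
  rw [fderiv_fun_mul (hφ.differentiable one_ne_zero x)
    (contDiff_gaussDensity.differentiable one_ne_zero x)]
  simp [gaussDiv, partialDeriv, fderiv_gaussDensity, EuclideanSpace.inner_single_right]
  ring

theorem integral_mul_gaussDiv (i : Fin n) (f : EuclideanSpace ℝ (Fin n) → ℝ)
    {φ : EuclideanSpace ℝ (Fin n) → ℝ} (hφ : ContDiff ℝ 1 φ) :
    ∫ x, f x * gaussDiv i φ x ∂(gaussian n) =
      -∫ x, f x * fderiv ℝ (fun y => φ y * gaussDensity n y) x (EuclideanSpace.single i 1) := by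
  rw [integral_gaussian, ← integral_neg]
  refine integral_congr_ae (Eventually.of_forall fun x => ?_)
  have := gaussDensity_mul_gaussDiv i hφ x
  simp only
  linear_combination f x * this

/-- The map φ ↦ φγ is a bijection of the compactly supported C¹ functions, with inverse ψ ↦ ψ/γ, and
it exchanges the two integration by parts formulas. -/
theorem isWeakPartialDeriv_iff {i : Fin n} {f g : EuclideanSpace ℝ (Fin n) → ℝ} :
    IsWeakPartialDeriv i f g ↔ HasWeakDeriv (EuclideanSpace.single i 1) f g := by
  rw [IsWeakPartialDeriv, HasWeakDeriv, locallyIntegrable_gaussian_iff,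
    locallyIntegrable_gaussian_iff]
  refine and_congr_right fun _ => and_congr_right fun _ => ⟨fun h ψ hψ hc => ?_, fun h φ hφ hc => ?_⟩
  · have hφ : ContDiff ℝ 1 (fun x => ψ x * (gaussDensity n x)⁻¹) :=
      hψ.mul (contDiff_gaussDensity.inv fun x => (gaussDensity_pos x).ne')
    have h1 := h _ hφ hc.mul_right
    rw [integral_mul_gaussDiv i f hφ, integral_gaussian] at h1
    have h2 : (fun x => ψ x * (gaussDensity n x)⁻¹ * gaussDensity n x) = ψ := by
      ext x
      simp [(gaussDensity_pos x).ne']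
    rw [h2] at h1
    rw [← h1]
    refine integral_congr_ae (Eventually.of_forall fun x => ?_)
    have := (gaussDensity_pos x).ne'
    simp only
    field_simp
  · rw [integral_mul_gaussDiv i f hφ, integral_gaussian,
      ← h _ (hφ.mul contDiff_gaussDensity) hc.mul_right]
    refine integral_congr_ae (Eventually.of_forall fun x => ?_)
    simp only
    ring

/-- The continuously differentiable functions with compact support. -/
def compactlySupportedC1 (n : ℕ) : Submodule ℝ (EuclideanSpace ℝ (Fin n) → ℝ) where
  carrier := {φ | ContDiff ℝ 1 φ ∧ HasCompactSupport φ}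
  add_mem' h h' := ⟨h.1.add h'.1, h.2.add h'.2⟩
  zero_mem' := ⟨contDiff_const, HasCompactSupport.zero⟩
  smul_mem' c _ h := ⟨h.1.const_smul c, h.2.smul_left (f := fun _ => c)⟩

theorem integrable_mul_fderiv_mul_gaussDensity {F φ : EuclideanSpace ℝ (Fin n) → ℝ}
    (hF : LocallyIntegrable F) (hφ : ContDiff ℝ 1 φ) (hc : HasCompactSupport φ)
    (e : EuclideanSpace ℝ (Fin n)) :
    Integrable (fun x => F x * fderiv ℝ (fun y => φ y * gaussDensity n y) x e) := by
  have h1 : ContDiff ℝ 1 (fun y => φ y * gaussDensity n y) := hφ.mul contDiff_gaussDensity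
  have h2 : HasCompactSupport (fun y => φ y * gaussDensity n y) := hc.mul_right
  exact integrable_mul_of_hasCompactSupport hF
    ((h1.continuous_fderiv one_ne_zero).clm_apply continuous_const) (h2.fderiv_apply ℝ e)

/-- A function whose distributional derivative is dominated by a function `D ∈ L²(γ)` has a weak
derivative, and it is bounded by `D`. -/
theorem exists_hasWeakDeriv_of_le {F D : EuclideanSpace ℝ (Fin n) → ℝ}
    {e : EuclideanSpace ℝ (Fin n)} (hF : LocallyIntegrable F) (hD : MemLp D 2 (gaussian n))
    (h : ∀ ψ : EuclideanSpace ℝ (Fin n) → ℝ, ContDiff ℝ 1 ψ → HasCompactSupport ψ →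
      |∫ x, F x * fderiv ℝ ψ x e| ≤ ∫ x, D x * |ψ x|) :
    ∃ u, HasWeakDeriv e F u ∧ ∀ᵐ x, |u x| ≤ D x := by
  have hV : ∀ φ ∈ compactlySupportedC1 n, MemLp φ 2 (gaussian n) := fun φ hφ =>
    hφ.1.continuous.memLp_of_hasCompactSupport hφ.2
  -- The distributional derivative of F applied to φγ, so that a representative in L²(γ) is an
  -- ordinary weak derivative.
  let T : compactlySupportedC1 n →ₗ[ℝ] ℝ :=
    { toFun := fun φ => -∫ x, F x * fderiv ℝ (fun y => φ.1 y * gaussDensity n y) x e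
      map_add' := fun φ φ' => by
        rw [← neg_add, ← integral_add (integrable_mul_fderiv_mul_gaussDensity hF φ.2.1 φ.2.2 e)
          (integrable_mul_fderiv_mul_gaussDensity hF φ'.2.1 φ'.2.2 e)]
        congr 1
        refine integral_congr_ae (Eventually.of_forall fun x => ?_)
        have d1 : DifferentiableAt ℝ (fun y => φ.1 y * gaussDensity n y) x :=
          (φ.2.1.mul contDiff_gaussDensity).differentiable one_ne_zero x
        have d2 : DifferentiableAt ℝ (fun y => φ'.1 y * gaussDensity n y) x :=
          (φ'.2.1.mul contDiff_gaussDensity).differentiable one_ne_zero x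
        simp only [Submodule.coe_add, Pi.add_apply, add_mul]
        rw [fderiv_fun_add d1 d2]
        simp [mul_add]
      map_smul' := fun c φ => by
        simp only [Submodule.coe_smul, Pi.smul_apply, smul_eq_mul, RingHom.id_apply, mul_neg,
          ← integral_const_mul]
        congr 1
        refine integral_congr_ae (Eventually.of_forall fun x => ?_)
        have d1 : DifferentiableAt ℝ (fun y => φ.1 y * gaussDensity n y) x :=
          (φ.2.1.mul contDiff_gaussDensity).differentiable one_ne_zero x
        simp only [mul_assoc c]
        rw [fderiv_const_mul d1]
        simp [mul_left_comm] }
  have hT : ∀ φ : compactlySupportedC1 n,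
      |T φ| ≤ (eLpNorm D 2 (gaussian n)).toReal * (eLpNorm φ.1 2 (gaussian n)).toReal := by
    intro φ
    have h1 : |T φ| ≤ ∫ x, D x * |φ.1 x| ∂(gaussian n) := by
      have := h _ (φ.2.1.mul contDiff_gaussDensity) φ.2.2.mul_right
      rw [integral_gaussian]
      simp only [T, LinearMap.coe_mk, AddHom.coe_mk, abs_neg]
      refine this.trans_eq (integral_congr_ae (Eventually.of_forall fun x => ?_))
      simp only [abs_mul, abs_of_pos (gaussDensity_pos x)]
      ring
    have hφ := hV φ.1 φ.2
    have h2 := real_inner_le_norm (hφ.abs.toLp) (hD.toLp)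
    rw [L2.inner_def, Lp.norm_toLp, Lp.norm_toLp] at h2
    have h3 : eLpNorm |φ.1| 2 (gaussian n) = eLpNorm φ.1 2 (gaussian n) :=
      eLpNorm_congr_norm_ae (Eventually.of_forall fun x => by simp)
    rw [h3] at h2
    rw [mul_comm]
    refine h1.trans (le_trans (le_of_eq ?_) h2)
    refine integral_congr_ae ?_
    filter_upwards [hφ.abs.coeFn_toLp, hD.coeFn_toLp] with x h4 h5
    simp [h4, h5]
  obtain ⟨u, hu, huT⟩ := exists_memLp_two_integral_mul_eq _ hV T _ hT
  have hui : LocallyIntegrable u := locallyIntegrable_gaussian_iff.1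
    ((hu.integrable one_le_two).locallyIntegrable)
  have hDi : LocallyIntegrable D := locallyIntegrable_gaussian_iff.1
    ((hD.integrable one_le_two).locallyIntegrable)
  have hw : HasWeakDeriv e F u := by
    refine ⟨hF, hui, fun ψ hψ hc => ?_⟩
    have hφ : ContDiff ℝ 1 (fun x => ψ x * (gaussDensity n x)⁻¹) :=
      hψ.mul (contDiff_gaussDensity.inv fun x => (gaussDensity_pos x).ne')
    have h1 := huT ⟨fun x => ψ x * (gaussDensity n x)⁻¹, hφ, hc.mul_right⟩
    have h2 : (fun x => ψ x * (gaussDensity n x)⁻¹ * gaussDensity n x) = ψ := by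
      ext x
      simp [(gaussDensity_pos x).ne']
    simp only [T, LinearMap.coe_mk, AddHom.coe_mk, h2] at h1
    rw [h1, integral_gaussian]
    refine integral_congr_ae (Eventually.of_forall fun x => ?_)
    have := (gaussDensity_pos x).ne'
    simp only
    field_simp
  refine ⟨u, hw, ?_⟩
  -- The L² bound only produced u. The pointwise bound comes from the hypothesis again, with
  -- nonnegative ψ, which makes D − u and D + u nonnegative.
  have hb : ∀ ψ : EuclideanSpace ℝ (Fin n) → ℝ, ContDiff ℝ 1 ψ → HasCompactSupport ψ →
      (∀ x, 0 ≤ ψ x) → |∫ x, u x * ψ x| ≤ ∫ x, D x * ψ x := by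
    intro ψ hψ hc hp
    rw [hw.2.2 ψ hψ hc, abs_neg]
    simpa only [abs_of_nonneg (hp _)] using h ψ hψ hc
  have h1 : ∀ᵐ x, 0 ≤ D x - u x := by
    refine ae_nonneg_of_forall_integral_contDiff_mul_nonneg (hDi.sub hui) fun ψ hψ hc hp => ?_
    simp only [sub_mul]
    rw [integral_sub (integrable_mul_of_hasCompactSupport hDi hψ.continuous hc)
      (integrable_mul_of_hasCompactSupport hui hψ.continuous hc)]
    linarith [(abs_le.1 (hb ψ hψ hc hp)).2]
  have h2 : ∀ᵐ x, 0 ≤ D x + u x := by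
    refine ae_nonneg_of_forall_integral_contDiff_mul_nonneg (hDi.add hui) fun ψ hψ hc hp => ?_
    simp only [add_mul]
    rw [integral_add (integrable_mul_of_hasCompactSupport hDi hψ.continuous hc)
      (integrable_mul_of_hasCompactSupport hui hψ.continuous hc)]
    linarith [(abs_le.1 (hb ψ hψ hc hp)).1]
  filter_upwards [h1, h2] with x h1 h2
  exact abs_le.2 ⟨by linarith, by linarith⟩

end Gaussian

/-! ### Orlicz membership as exponential integrability -/

section Orlicz

variable {α : Type*} [MeasurableSpace α] {μ : Measure α} [IsProbabilityMeasure μ] {k : ℕ}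

theorem exp_le_two_mul_cosh₂_add_two (x : ℝ) : Real.exp x ≤ 2 * cosh₂ x + 2 := by
  rw [cosh₂, Real.cosh_eq]
  linarith [Real.exp_pos (-x)]

/-- Convexity of exp between 0 and ±x. The factor t lets rescaling bring any finite exponential
integral below the threshold 1. -/
theorem cosh₂_mul_le {t x : ℝ} (ht : 0 ≤ t) (ht1 : t ≤ 1) (hx : 0 ≤ x) :
    cosh₂ (t * x) ≤ t * Real.exp x := by
  have h := fun y : ℝ => convexOn_exp.2 (mem_univ y) (mem_univ 0) ht (sub_nonneg.2 ht1)
    (add_sub_cancel t 1)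
  have h1 := h x
  have h2 := h (-x)
  have h3 : Real.exp (-x) ≤ Real.exp x := Real.exp_le_exp.2 (by linarith)
  simp only [smul_eq_mul, mul_zero, add_zero, Real.exp_zero, mul_one, mul_neg] at h1 h2
  have h4 : t * Real.exp (-x) ≤ t * Real.exp x := mul_le_mul_of_nonneg_left h3 ht
  rw [cosh₂, Real.cosh_eq]
  linarith

/-- Membership in the Orlicz space of `x ↦ cosh₂ (|x| ^ k)` is exponential integrability of the
`k`-th power. -/
theorem memOrliczPow_cosh₂_iff (hk : k ≠ 0) {f : α → ℝ} :
    MemOrliczPow cosh₂ k μ f ↔ AEStronglyMeasurable f μ ∧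
      ∃ c : ℝ, 0 < c ∧ ∫⁻ x, ENNReal.ofReal (Real.exp (c * |f x| ^ k)) ∂μ < ∞ := by
  refine and_congr_right fun hf => ⟨fun ⟨ρ, hρ, h⟩ => ?_, fun ⟨c, hc, h⟩ => ?_⟩
  · refine ⟨ρ⁻¹ ^ k, by positivity, ?_⟩
    calc ∫⁻ x, ENNReal.ofReal (Real.exp (ρ⁻¹ ^ k * |f x| ^ k)) ∂μ
      _ ≤ ∫⁻ x, (2 * ENNReal.ofReal (cosh₂ (|(ρ⁻¹ * |f x|)| ^ k)) + 2) ∂μ := by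
        refine lintegral_mono fun x => ?_
        have h0 : |(ρ⁻¹ * |f x|)| = ρ⁻¹ * |f x| := abs_of_nonneg (by positivity)
        have h1 := exp_le_two_mul_cosh₂_add_two (ρ⁻¹ ^ k * |f x| ^ k)
        rw [h0, mul_pow]
        refine (ENNReal.ofReal_le_ofReal h1).trans (ENNReal.ofReal_add_le.trans ?_)
        rw [ENNReal.ofReal_mul (by norm_num)]
        simp
      _ < ∞ := by
        rw [lintegral_add_right _ measurable_const, lintegral_const_mul' _ _ (by simp)]
        simp only [lintegral_const, measure_univ, mul_one]
        exact ENNReal.add_lt_top.2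
          ⟨ENNReal.mul_lt_top (by simp) (h.trans_lt (by simp)), by simp⟩
  · set M := (∫⁻ x, ENNReal.ofReal (Real.exp (c * |f x| ^ k)) ∂μ).toReal with hM
    have hM0 : 0 ≤ M := ENNReal.toReal_nonneg
    have hM' : ∫⁻ x, ENNReal.ofReal (Real.exp (c * |f x| ^ k)) ∂μ = ENNReal.ofReal M :=
      (ENNReal.ofReal_toReal h.ne).symm
    -- Chosen so that t = r ^ k / c satisfies t(1 + M) ≤ 1; the bound r ≤ 1 gives r ^ k ≤ r, as k ≠
    -- 0.
    set r := min 1 (c / (1 + M)) with hr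
    have hr0 : 0 < r := lt_min one_pos (by positivity)
    have hrk : r ^ k ≤ c / (1 + M) :=
      (pow_le_of_le_one hr0.le (min_le_left _ _) hk).trans (min_le_right _ _)
    set t := r ^ k / c with ht
    have ht0 : 0 ≤ t := by positivity
    have ht1 : t ≤ 1 / (1 + M) := by
      rw [ht, div_le_iff₀ hc]
      refine hrk.trans (le_of_eq ?_)
      ring
    have ht2 : t ≤ 1 := ht1.trans (by rw [div_le_one (by positivity)]; linarith)
    refine ⟨r⁻¹, inv_pos.2 hr0, ?_⟩
    calc ∫⁻ x, ENNReal.ofReal (cosh₂ (|(r⁻¹⁻¹ * |f x|)| ^ k)) ∂μ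
      _ ≤ ∫⁻ x, ENNReal.ofReal t * ENNReal.ofReal (Real.exp (c * |f x| ^ k)) ∂μ := by
        refine lintegral_mono fun x => ?_
        have h0 : |(r⁻¹⁻¹ * |f x|)| ^ k = t * (c * |f x| ^ k) := by
          rw [inv_inv, abs_of_nonneg (by positivity), mul_pow, ht]
          field_simp
        rw [h0, ← ENNReal.ofReal_mul ht0]
        exact ENNReal.ofReal_le_ofReal (cosh₂_mul_le ht0 ht2 (by positivity))
      _ = ENNReal.ofReal (t * M) := by
        rw [lintegral_const_mul' _ _ (by simp), hM', ENNReal.ofReal_mul ht0]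
      _ ≤ 1 := by
        refine ENNReal.ofReal_le_one.2 ?_
        calc t * M ≤ 1 / (1 + M) * M := mul_le_mul_of_nonneg_right ht1 hM0
          _ ≤ 1 := by rw [one_div_mul_eq_div, div_le_one (by positivity)]; linarith

theorem add_add_pow_le {a b d : ℝ} (ha : 0 ≤ a) (hb : 0 ≤ b) (hd : 0 ≤ d) (k : ℕ) :
    ∃ y, (y = a ∨ y = b ∨ y = d) ∧ (a + b + d) ^ k ≤ 3 ^ k * y ^ k := by
  simp only [← mul_pow]
  rcases le_total a b with h1 | h1 <;> rcases le_total b d with h2 | h2 <;>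
    rcases le_total a d with h3 | h3
  all_goals first
    | exact ⟨a, Or.inl rfl, pow_le_pow_left₀ (by positivity) (by linarith) k⟩
    | exact ⟨b, Or.inr (Or.inl rfl), pow_le_pow_left₀ (by positivity) (by linarith) k⟩
    | exact ⟨d, Or.inr (Or.inr rfl), pow_le_pow_left₀ (by positivity) (by linarith) k⟩

/-- A sum of three terms is at most three times the largest, so exp(c|F|^k) is bounded by the sum of
three integrable exponentials once c is small; no Hölder inequality is needed. -/
theorem MemOrliczPow.of_abs_le (hk : k ≠ 0) {f g F : α → ℝ} {A K : ℝ} (hA : 0 ≤ A) (hK : 0 ≤ K)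
    (hf : MemOrliczPow cosh₂ k μ f) (hg : MemOrliczPow cosh₂ k μ g)
    (hF : AEStronglyMeasurable F μ) (h : ∀ᵐ x ∂μ, |F x| ≤ A + K * |f x| + K * |g x|) :
    MemOrliczPow cosh₂ k μ F := by
  rw [memOrliczPow_cosh₂_iff hk] at hf hg ⊢
  obtain ⟨hfm, cf, hcf, hf⟩ := hf
  obtain ⟨hgm, cg, hcg, hg⟩ := hg
  -- Absorbs the factor 3 ^ k * K ^ k; K + 1 keeps the denominator positive when K = 0.
  set c := min cf cg / (3 ^ k * (K + 1) ^ k) with hc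
  have hmin : 0 < min cf cg := lt_min hcf hcg
  have hc0 : 0 < c := by positivity
  refine ⟨hF, c, hc0, ?_⟩
  have hcK : c * (3 ^ k * K ^ k) ≤ min cf cg := by
    rw [hc, div_mul_eq_mul_div, div_le_iff₀ (by positivity)]
    gcongr
    linarith
  have hlt : ∫⁻ x, (ENNReal.ofReal (Real.exp (c * (3 ^ k * A ^ k))) +
      (ENNReal.ofReal (Real.exp (cf * |f x| ^ k)) +
      ENNReal.ofReal (Real.exp (cg * |g x| ^ k)))) ∂μ < ∞ := by
    rw [lintegral_add_left measurable_const, lintegral_add_left']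
    · simp only [lintegral_const, measure_univ, mul_one]
      exact ENNReal.add_lt_top.2 ⟨by simp, ENNReal.add_lt_top.2 ⟨hf, hg⟩⟩
    · have := hfm.aemeasurable
      fun_prop
  refine (lintegral_mono_ae ?_).trans_lt hlt
  filter_upwards [h] with x hx
  obtain ⟨y, hy, hyk⟩ := add_add_pow_le hA (mul_nonneg hK (abs_nonneg (f x)))
    (mul_nonneg hK (abs_nonneg (g x))) k
  have h1 : c * |F x| ^ k ≤ c * (3 ^ k * y ^ k) :=
    mul_le_mul_of_nonneg_left ((pow_le_pow_left₀ (abs_nonneg _) hx k).trans hyk) hc0.le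
  have hKb : ∀ z : ℝ, 0 ≤ z → ∀ c' : ℝ, min cf cg ≤ c' →
      c * (3 ^ k * (K * z) ^ k) ≤ c' * z ^ k := fun z hz c' hc' => by
    rw [mul_pow, ← mul_assoc (3 ^ k), ← mul_assoc c]
    exact mul_le_mul_of_nonneg_right (hcK.trans hc') (by positivity)
  refine (ENNReal.ofReal_le_ofReal (Real.exp_le_exp.2 h1)).trans ?_
  rcases hy with rfl | rfl | rfl
  · exact le_self_add
  · refine le_add_left (le_trans ?_ le_self_add)
    exact ENNReal.ofReal_le_ofReal (Real.exp_le_exp.2 (hKb _ (abs_nonneg _) _ (min_le_left _ _)))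
  · refine le_add_left (le_trans ?_ le_add_self)
    exact ENNReal.ofReal_le_ofReal (Real.exp_le_exp.2 (hKb _ (abs_nonneg _) _ (min_le_right _ _)))

/-- From y^m ≤ m! exp y. The order m = 2 serves the Riesz argument, m = 2n + 1 Morrey's embedding.
-/
theorem MemOrliczPow.integrable_abs_pow (hk : k ≠ 0) {f : α → ℝ}
    (hf : MemOrliczPow cosh₂ k μ f) (m : ℕ) : Integrable (fun x => |f x| ^ m) μ := by
  rw [memOrliczPow_cosh₂_iff hk] at hf
  obtain ⟨hfm, c, hc, hf⟩ := hf
  have hi : Integrable (fun x => Real.exp (c * |f x| ^ k)) μ := by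
    refine ⟨?_, ?_⟩
    · have := hfm.aemeasurable
      exact (by fun_prop : AEMeasurable (fun x => Real.exp (c * |f x| ^ k)) μ).aestronglyMeasurable
    · rw [hasFiniteIntegral_iff_ofReal (Eventually.of_forall fun x => (Real.exp_pos _).le)]
      exact hf
  refine ((integrable_const (1 : ℝ)).add (hi.const_mul (m.factorial / c ^ m))).mono'
    (hfm.norm.pow m) (Eventually.of_forall fun x => ?_)
  simp only [Real.norm_eq_abs, abs_pow, abs_abs, Pi.add_apply]
  have h1 : |f x| ^ m ≤ 1 + (|f x| ^ k) ^ m := by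
    rcases le_total |f x| 1 with h | h
    · exact (pow_le_one₀ (abs_nonneg _) h).trans (le_add_of_nonneg_right (by positivity))
    · exact (pow_le_pow_left₀ (abs_nonneg _) (le_self_pow₀ h hk) m).trans (by linarith)
  have h2 := Real.pow_div_factorial_le_exp (c * |f x| ^ k) (by positivity) m
  rw [mul_pow, div_le_iff₀ (by positivity)] at h2
  refine h1.trans (add_le_add_right ?_ 1)
  rw [div_mul_eq_mul_div, le_div_iff₀ (by positivity)]
  linarith

theorem MemOrliczPow.memLp_two (hk : k ≠ 0) {f : α → ℝ} (hf : MemOrliczPow cosh₂ k μ f) :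
    MemLp f 2 μ := by
  rw [memLp_two_iff_integrable_sq hf.1]
  simpa using hf.integrable_abs_pow hk 2

end Orlicz

/-! ### Stability under Lipschitz functions -/

theorem MemOrliczPow.locallyIntegrable {n k : ℕ} (hk : k ≠ 0) {f : EuclideanSpace ℝ (Fin n) → ℝ}
    (hf : MemOrliczPow cosh₂ k (gaussian n) f) : LocallyIntegrable f :=
  locallyIntegrable_gaussian_iff.1 ((hf.memLp_two hk).integrable one_le_two).locallyIntegrable

theorem ae_intervalIntegrable_comp_add {E : Type*} [NormedAddCommGroup E] [InnerProductSpace ℝ E]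
    [FiniteDimensional ℝ E] [MeasurableSpace E] [BorelSpace E] {D : E → ℝ}
    (hD : LocallyIntegrable D) (e : E) {t : ℝ} (ht : 0 ≤ t) :
    ∀ᵐ x, IntervalIntegrable (fun s => D (x + s • e)) volume 0 t := by
  have h : ∀ N : ℕ, ∀ᵐ x : E, x ∈ Metric.closedBall 0 (N : ℝ) →
      IntervalIntegrable (fun s => D (x + s • e)) volume 0 t := by
    intro N
    obtain ⟨ψ, h1, -, hc, -⟩ := exists_continuous_one_zero_of_isCompact
      (isCompact_closedBall (0 : E) N) isClosed_empty (disjoint_empty _)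
    filter_upwards [(integrable_prod_comp_add_mul hD ψ.continuous hc e t).prod_left_ae] with x hx hN
    rw [intervalIntegrable_iff_integrableOn_Ioc_of_le ht]
    simpa [h1 hN, IntegrableOn] using hx
  filter_upwards [ae_all_iff.2 h] with x hx
  obtain ⟨N, hN⟩ := exists_nat_ge ‖x‖
  exact hx N (by simpa using hN)

/-- Lipschitz functions of two elements of the Gaussian Orlicz–Sobolev space are in that space. -/
theorem lipschitz_comp_mem_orliczSobolev {n : ℕ} {f g : EuclideanSpace ℝ (Fin n) → ℝ}
    (hf : f ∈ orliczSobolev n) (hg : g ∈ orliczSobolev n) {Φ : ℝ → ℝ → ℝ} {K : ℝ} (hK : 0 ≤ K)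
    (hΦ : ∀ a b a' b', |Φ a b - Φ a' b'| ≤ K * |a - a'| + K * |b - b'|) :
    (fun x => Φ (f x) (g x)) ∈ orliczSobolev n := by
  have hcont : Continuous (fun p : ℝ × ℝ => Φ p.1 p.2) := by
    refine continuous_iff_continuousAt.2 fun p => ?_
    rw [ContinuousAt, tendsto_iff_dist_tendsto_zero]
    refine squeeze_zero (fun _ => dist_nonneg) (fun q => hΦ q.1 q.2 p.1 p.2) ?_
    have : Continuous (fun q : ℝ × ℝ => K * |q.1 - p.1| + K * |q.2 - p.2|) := by fun_prop
    simpa using this.tendsto p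
  have hF : MemOrliczPow cosh₂ 1 (gaussian n) (fun x => Φ (f x) (g x)) := by
    refine MemOrliczPow.of_abs_le one_ne_zero (abs_nonneg (Φ 0 0)) hK hf.1 hg.1
      (hcont.comp_aestronglyMeasurable (hf.1.1.prodMk hg.1.1)) (Eventually.of_forall fun x => ?_)
    have h := hΦ (f x) (g x) 0 0
    simp only [sub_zero] at h
    linarith [abs_sub_abs_le_abs_sub (Φ (f x) (g x)) (Φ 0 0)]
  have hFi := hF.locallyIntegrable one_ne_zero
  refine ⟨hF, fun i => ?_⟩
  obtain ⟨f', hf', hf'o⟩ := hf.2 i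
  obtain ⟨g', hg', hg'o⟩ := hg.2 i
  rw [isWeakPartialDeriv_iff] at hf' hg'
  set e : EuclideanSpace ℝ (Fin n) := EuclideanSpace.single i 1
  set D : EuclideanSpace ℝ (Fin n) → ℝ := fun x => K * |f' x| + K * |g' x| with hD
  have hD0 : ∀ x, 0 ≤ D x := fun x => by positivity
  have hDo : MemOrliczPow cosh₂ 2 (gaussian n) D := by
    refine MemOrliczPow.of_abs_le two_ne_zero le_rfl hK hf'o hg'o
      ((hf'o.1.norm.const_mul K).add (hg'o.1.norm.const_mul K)) (Eventually.of_forall fun x => ?_)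
    rw [abs_of_nonneg (hD0 x), zero_add]
  -- The Lipschitz bound is applied to increments, where f and g are integrals of f' and g'; Φ is
  -- never differentiated.
  have hFD : ∀ t : ℝ, 0 < t → ∀ᵐ x, |Φ (f (x + t • e)) (g (x + t • e)) - Φ (f x) (g x)| ≤
      ∫ s in (0:ℝ)..t, D (x + s • e) := by
    intro t ht
    filter_upwards [hf'.ae_sub_eq_intervalIntegral ht.le, hg'.ae_sub_eq_intervalIntegral ht.le,
      ae_intervalIntegrable_comp_add hf'.2.1 e ht.le,
      ae_intervalIntegrable_comp_add hg'.2.1 e ht.le] with x h1 h2 h3 h4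
    refine (hΦ _ _ _ _).trans ?_
    rw [h1, h2, hD, intervalIntegral.integral_add (h3.abs.const_mul K) (h4.abs.const_mul K),
      intervalIntegral.integral_const_mul, intervalIntegral.integral_const_mul]
    exact add_le_add
      (mul_le_mul_of_nonneg_left (intervalIntegral.abs_integral_le_integral_abs ht.le) hK)
      (mul_le_mul_of_nonneg_left (intervalIntegral.abs_integral_le_integral_abs ht.le) hK)
  obtain ⟨u, hu, huD⟩ := exists_hasWeakDeriv_of_le (e := e) hFi (hDo.memLp_two two_ne_zero)
    fun ψ hψ hc => abs_integral_mul_fderiv_le hFi (hDo.locallyIntegrable two_ne_zero) hFD hψ hc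
  refine ⟨u, isWeakPartialDeriv_iff.2 hu, ?_⟩
  refine MemOrliczPow.of_abs_le two_ne_zero le_rfl hK hf'o hg'o
    (locallyIntegrable_gaussian_iff.2 hu.2.1).aestronglyMeasurable ?_
  filter_upwards [ae_gaussian_iff.2 huD] with x hx
  rwa [zero_add]

/-- A primitive of a function bounded by K is K-Lipschitz; the second argument of Φ is a dummy. -/
theorem primitive_comp_mem_orliczSobolev {n : ℕ} {G g : ℝ → ℝ} (hG : IsPrimitive G g)
    (hg : ∃ K : ℝ, ∀ t, |g t| ≤ K) {f : EuclideanSpace ℝ (Fin n) → ℝ} (hf : f ∈ orliczSobolev n) :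
    (fun x => G (f x)) ∈ orliczSobolev n := by
  obtain ⟨K, hK⟩ := hg
  have hK0 : 0 ≤ K := (abs_nonneg _).trans (hK 0)
  refine lipschitz_comp_mem_orliczSobolev (Φ := fun a _ => G a) hf hf hK0 fun a b a' b' => ?_
  have h := intervalIntegral.norm_integral_le_of_norm_le_const (a := a') (b := a) (f := g) (C := K)
    fun t _ => hK t
  rw [← hG.2, Real.norm_eq_abs] at h
  exact h.trans (le_add_of_nonneg_right (by positivity))

theorem min_mem_orliczSobolev {n : ℕ} {f g : EuclideanSpace ℝ (Fin n) → ℝ}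
    (hf : f ∈ orliczSobolev n) (hg : g ∈ orliczSobolev n) :
    (fun x => min (f x) (g x)) ∈ orliczSobolev n := by
  refine lipschitz_comp_mem_orliczSobolev (Φ := min) hf hg zero_le_one fun a b a' b' => ?_
  rw [one_mul, one_mul]
  exact (abs_min_sub_min_le_max a b a' b').trans
    (max_le_add_of_nonneg (abs_nonneg _) (abs_nonneg _))

theorem max_mem_orliczSobolev {n : ℕ} {f g : EuclideanSpace ℝ (Fin n) → ℝ}
    (hf : f ∈ orliczSobolev n) (hg : g ∈ orliczSobolev n) :
    (fun x => max (f x) (g x)) ∈ orliczSobolev n := by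
  refine lipschitz_comp_mem_orliczSobolev (Φ := max) hf hg zero_le_one fun a b a' b' => ?_
  rw [one_mul, one_mul]
  exact (abs_max_sub_max_le_max a b a' b').trans
    (max_le_add_of_nonneg (abs_nonneg _) (abs_nonneg _))

/-! ### Tools for Morrey's embedding -/

section Morrey

variable {E : Type*} [NormedAddCommGroup E] [InnerProductSpace ℝ E] [FiniteDimensional ℝ E]
  [MeasurableSpace E] [BorelSpace E]

/-- A function that is the locally uniform limit of continuous functions, up to null sets, has a
continuous version. -/
theorem exists_continuous_ae_eq_of_ae_edist_le {f : E → ℝ} {h : ℕ → E → ℝ}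
    (hc : ∀ k, Continuous (h k))
    (H : ∀ R : ℕ, ∃ ε : ℕ → ℝ≥0∞, Tendsto ε atTop (𝓝 0) ∧
      ∀ k, ∀ᵐ x : E, x ∈ Metric.ball 0 (R : ℝ) → edist (h k x) (f x) ≤ ε k) :
    ∃ f' : E → ℝ, Continuous f' ∧ f =ᵐ[volume] f' := by
  choose ε hε hεb using H
  have hkl : ∀ R : ℕ, ∀ k l, ∀ x ∈ Metric.ball (0 : E) R,
      edist (h k x) (h l x) ≤ ε R k + ε R l := by
    intro R k l
    -- The set where the Cauchy estimate fails is open by continuity and null by hypothesis, hence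
    -- empty: the estimate holds everywhere on the ball.
    have hopen : IsOpen (Metric.ball (0 : E) R ∩ {x | ε R k + ε R l < edist (h k x) (h l x)}) :=
      Metric.isOpen_ball.inter (isOpen_lt continuous_const ((hc k).edist (hc l)))
    have hnull : volume (Metric.ball (0 : E) R ∩ {x | ε R k + ε R l < edist (h k x) (h l x)}) = 0 := by
      rw [measure_eq_zero_iff_ae_notMem]
      filter_upwards [hεb R k, hεb R l] with x h1 h2 hx
      refine absurd hx.2 (not_lt.2 ((edist_triangle_right _ _ (f x)).trans ?_))
      exact add_le_add (h1 hx.1) (h2 hx.1)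
    have hemp := hopen.eq_empty_of_measure_zero hnull
    intro x hx
    by_contra! hlt
    have : x ∈ Metric.ball (0 : E) R ∩ {x | ε R k + ε R l < edist (h k x) (h l x)} := ⟨hx, hlt⟩
    rw [hemp] at this
    exact this
  have hball : ∀ x : E, ∃ R : ℕ, x ∈ Metric.ball (0 : E) R := fun x => by
    obtain ⟨R, hR⟩ := exists_nat_gt ‖x‖
    exact ⟨R, by simpa using hR⟩
  have hcauchy : ∀ x, CauchySeq (fun k => h k x) := by
    intro x
    obtain ⟨R, hR⟩ := hball x
    rw [EMetric.cauchySeq_iff]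
    intro δ hδ
    have hδ2 : 0 < δ / 2 := ENNReal.half_pos hδ.ne'
    obtain ⟨N, hN⟩ := eventually_atTop.1 ((hε R).eventually_lt_const hδ2)
    refine ⟨N, fun k hk l hl => (hkl R k l x hR).trans_lt ?_⟩
    exact (ENNReal.add_lt_add (hN k hk) (hN l hl)).trans_eq (ENNReal.add_halves δ)
  choose f' hf' using fun x => cauchySeq_tendsto_of_complete (hcauchy x)
  have hlim : ∀ R : ℕ, ∀ k, ∀ x ∈ Metric.ball (0 : E) R, edist (h k x) (f' x) ≤ ε R k := by
    intro R k x hx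
    refine le_of_tendsto_of_tendsto' (tendsto_const_nhds.edist (hf' x))
      (?_ : Tendsto (fun l => ε R k + ε R l) atTop (𝓝 (ε R k))) fun l => hkl R k l x hx
    simpa using (hε R).const_add (ε R k)
  refine ⟨f', ?_, ?_⟩
  · have hunif : TendstoLocallyUniformly h f' atTop := by
      rw [EMetric.tendstoLocallyUniformly_iff]
      intro δ hδ x
      obtain ⟨R, hR⟩ := hball x
      refine ⟨Metric.ball 0 R, Metric.isOpen_ball.mem_nhds hR, ?_⟩
      filter_upwards [(hε R).eventually_lt_const hδ] with k hk y hy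
      rw [edist_comm]
      exact (hlim R k y hy).trans_lt hk
    exact hunif.continuous (Frequently.of_forall hc)
  · have hall : ∀ᵐ x : E, ∀ R k : ℕ, x ∈ Metric.ball 0 (R : ℝ) → edist (h k x) (f x) ≤ ε R k :=
      ae_all_iff.2 fun R => ae_all_iff.2 fun k => hεb R k
    filter_upwards [hall] with x hx
    obtain ⟨R, hR⟩ := hball x
    refine tendsto_nhds_unique ?_ (hf' x)
    rw [tendsto_iff_edist_tendsto_0]
    exact tendsto_of_tendsto_of_tendsto_of_le_of_le tendsto_const_nhds (hε R)
      (fun _ => zero_le) fun k => hx R k hR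

theorem HasWeakDeriv.congr {e : E} {f f' g g' : E → ℝ} (h : HasWeakDeriv e f g)
    (hf : f =ᵐ[volume] f') (hg : g =ᵐ[volume] g') : HasWeakDeriv e f' g' := by
  refine ⟨h.1.congr hf, h.2.1.congr hg, fun ψ hψ hc => ?_⟩
  have h1 : ∫ x, g' x * ψ x = ∫ x, g x * ψ x :=
    integral_congr_ae (by filter_upwards [hg] with x hx; rw [hx])
  have h2 : ∫ x, f' x * fderiv ℝ ψ x e = ∫ x, f x * fderiv ℝ ψ x e :=
    integral_congr_ae (by filter_upwards [hf] with x hx; rw [hx])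
  rw [h1, h2, h.2.2 ψ hψ hc]

theorem lintegral_comp_smul {F : E → ℝ≥0∞} (hF : Measurable F) {s : ℝ} (hs : 0 < s) :
    ENNReal.ofReal (s ^ Module.finrank ℝ E) * ∫⁻ w, F (s • w) = ∫⁻ y, F y := by
  have h : ∫⁻ w, F (s • w) = ∫⁻ y, F y ∂(Measure.map (fun w : E => s • w) volume) :=
    (lintegral_map hF (by fun_prop)).symm
  rw [h, Measure.map_addHaar_smul _ hs.ne', lintegral_smul_measure, smul_eq_mul, ← mul_assoc,
    ← ENNReal.ofReal_mul (by positivity), abs_of_pos (by positivity),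
    mul_inv_cancel₀ (by positivity)]
  simp

theorem mul_lintegral_ball_comp_add_smul_le {F : E → ℝ≥0∞} (hF : Measurable F) {s R : ℝ}
    (hs : 0 < s) (hs1 : s ≤ 1) {x : E} (hx : x ∈ Metric.ball 0 R) :
    ENNReal.ofReal (s ^ Module.finrank ℝ E) * ∫⁻ w in Metric.ball 0 1, F (x + s • w) ≤
      ∫⁻ y in Metric.ball 0 (R + 1), F y := by
  have hm : MeasurableSet (Metric.ball (0 : E) (R + 1)) := measurableSet_ball
  have h := lintegral_comp_smul (F := fun y => (Metric.ball (0 : E) (R + 1)).indicator F (x + y))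
    ((hF.indicator hm).comp (by fun_prop)) hs
  rw [lintegral_add_left_eq_self, lintegral_indicator hm] at h
  rw [← h]
  refine mul_le_mul_right ?_ _
  rw [← lintegral_indicator measurableSet_ball]
  refine lintegral_mono fun w => ?_
  by_cases hw : w ∈ Metric.ball (0 : E) 1
  · rw [indicator_of_mem hw, indicator_of_mem]
    simp only [mem_ball_zero_iff] at hx hw ⊢
    refine (norm_add_le _ _).trans_lt (add_lt_add_of_lt_of_le hx ?_)
    rw [norm_smul, Real.norm_of_nonneg hs.le]
    exact mul_le_one₀ hs1 (norm_nonneg _) hw.le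
  · rw [indicator_of_notMem hw]
    exact zero_le

/-- If a exceeds s^(-1/2), then s a² ≥ 1 and the second term alone suffices. This replaces Hölder's
inequality in Morrey's estimate: s^(-1/2) is integrable at 0, and s^n is the Jacobian of the
dilation by s in dimension n. -/
theorem le_rpow_add_pow_mul {a s : ℝ} (ha : 0 ≤ a) (hs : 0 < s) (n : ℕ) :
    a ≤ s ^ (-(1 / 2) : ℝ) + s ^ n * a ^ (2 * n + 1) := by
  have hl : 0 < s ^ (-(1 / 2) : ℝ) := Real.rpow_pos_of_pos hs _
  have hb : 0 ≤ s ^ n * a ^ (2 * n + 1) := by positivity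
  rcases le_total a (s ^ (-(1 / 2) : ℝ)) with h | h
  · linarith
  · have h2 : s⁻¹ ≤ a ^ 2 := by
      have := pow_le_pow_left₀ hl.le h 2
      rwa [← Real.rpow_natCast, ← Real.rpow_mul hs.le, show (-(1 / 2) : ℝ) * (2 : ℕ) = -1 by norm_num,
        Real.rpow_neg_one] at this
    have h3 : 1 ≤ s ^ n * a ^ (2 * n) := by
      rw [pow_mul, ← mul_pow]
      refine one_le_pow₀ ?_
      rwa [← div_le_iff₀' hs, one_div]
    have h4 : a ≤ s ^ n * a ^ (2 * n + 1) := by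
      rw [pow_succ, ← mul_assoc]
      exact le_mul_of_one_le_left ha h3
    linarith

/-- Averages of `f` against a dilated weight are continuous. -/
theorem continuous_integral_comp_add_smul_mul {f η : E → ℝ} (hf : LocallyIntegrable f)
    (hη : Continuous η) (hc : HasCompactSupport η) {r : ℝ} (hr : 0 < r) :
    Continuous (fun x => ∫ w, f (x + r • w) * η w) := by
  have hc' : HasCompactSupport (fun y => η (r⁻¹ • y)) :=
    hc.comp_homeomorph (Homeomorph.smulOfNeZero r⁻¹ (inv_ne_zero hr.ne'))
  have h : (fun x => ∫ w, f (x + r • w) * η w) =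
      fun x => (r ^ Module.finrank ℝ E)⁻¹ * ∫ y, f y * η (r⁻¹ • (y - x)) := by
    ext x
    have h1 := Measure.integral_comp_smul volume (fun y => f (x + y) * η (r⁻¹ • y)) r
    simp only [smul_smul, inv_mul_cancel₀ hr.ne', one_smul] at h1
    rw [h1, abs_of_pos (by positivity), smul_eq_mul]
    congr 1
    rw [← integral_add_left_eq_self (fun y => f y * η (r⁻¹ • (y - x))) x]
    simp
  rw [h]
  exact continuous_const.mul (continuous_integral_mul_comp_sub hf (by fun_prop) hc')

theorem integrable_comp_add_smul_mul {f η : E → ℝ} (hf : LocallyIntegrable f)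
    (hη : Continuous η) (hc : HasCompactSupport η) {r : ℝ} (hr : 0 < r) (x : E) :
    Integrable (fun w => f (x + r • w) * η w) := by
  have hc' : HasCompactSupport (fun y => η (r⁻¹ • y)) :=
    hc.comp_homeomorph (Homeomorph.smulOfNeZero r⁻¹ (inv_ne_zero hr.ne'))
  have h1 := integrable_comp_add_mul hf (ψ := fun y => η (r⁻¹ • y)) (by fun_prop) hc' x
  have h2 := h1.comp_smul hr.ne'
  simpa only [smul_smul, inv_mul_cancel₀ hr.ne', one_smul, add_comm] using h2

end Morrey

/-! ### Morrey's embedding and continuous versions -/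

section Euclidean

variable {n : ℕ}

theorem HasWeakDeriv.sum {f : EuclideanSpace ℝ (Fin n) → ℝ}
    {g : Fin n → EuclideanSpace ℝ (Fin n) → ℝ} (hf : LocallyIntegrable f)
    (h : ∀ i, HasWeakDeriv (EuclideanSpace.single i 1) f (g i)) (w : EuclideanSpace ℝ (Fin n)) :
    HasWeakDeriv w f (fun x => ∑ i, w i * g i x) := by
  have hg : LocallyIntegrable (fun x => ∑ i, w i * g i x) :=
    locallyIntegrable_finsetSum _ fun i _ => (h i).2.1.smul (w i)
  refine ⟨hf, hg, fun ψ hψ hc => ?_⟩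
  have h1 : ∀ x, fderiv ℝ ψ x w = ∑ i, w i * fderiv ℝ ψ x (EuclideanSpace.single i 1) := by
    intro x
    conv_lhs => rw [← (EuclideanSpace.basisFun (Fin n) ℝ).sum_repr w]
    simp
  simp only [h1, Finset.sum_mul, Finset.mul_sum]
  rw [integral_finsetSum, integral_finsetSum, ← Finset.sum_neg_distrib]
  · refine Finset.sum_congr rfl fun i _ => ?_
    simp only [mul_assoc, mul_left_comm (f _)]
    rw [integral_const_mul, integral_const_mul, (h i).2.2 ψ hψ hc, mul_neg]
  · intro i _
    simp only [mul_left_comm (f _)]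
    exact (integrable_mul_of_hasCompactSupport hf
      ((hψ.continuous_fderiv one_ne_zero).clm_apply continuous_const)
      (hc.fderiv_apply ℝ _)).const_mul _
  · intro i _
    simp only [mul_assoc]
    exact (integrable_mul_of_hasCompactSupport (h i).2.1 hψ.continuous hc).const_mul _

theorem HasWeakDeriv.ae_enorm_sub_le {f : EuclideanSpace ℝ (Fin n) → ℝ}
    {g : Fin n → EuclideanSpace ℝ (Fin n) → ℝ} (hf : LocallyIntegrable f)
    (h : ∀ i, HasWeakDeriv (EuclideanSpace.single i 1) f (g i)) {w : EuclideanSpace ℝ (Fin n)}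
    (hw : ‖w‖ ≤ 1) {r : ℝ} (hr : 0 ≤ r) :
    ∀ᵐ x, ‖f (x + r • w) - f x‖ₑ ≤
      ∫⁻ s in Ioc 0 r, ENNReal.ofReal (∑ i, |g i (x + s • w)|) := by
  filter_upwards [(HasWeakDeriv.sum hf h w).ae_sub_eq_intervalIntegral hr] with x hx
  rw [hx, intervalIntegral.integral_of_le hr]
  refine (enorm_integral_le_lintegral_enorm _).trans (lintegral_mono fun s => ?_)
  rw [← ofReal_norm]
  refine ENNReal.ofReal_le_ofReal ((norm_sum_le _ _).trans (Finset.sum_le_sum fun i _ => ?_))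
  rw [norm_mul, Real.norm_eq_abs (g i _)]
  exact mul_le_of_le_one_left (abs_nonneg _) ((PiLp.norm_apply_le w i).trans hw)

/-- **Morrey's embedding**: a function whose first weak derivatives are locally integrable with an
exponent larger than the dimension has a continuous version. -/
theorem exists_continuous_ae_eq_of_hasWeakDeriv {f : EuclideanSpace ℝ (Fin n) → ℝ}
    {g : Fin n → EuclideanSpace ℝ (Fin n) → ℝ} (hf : LocallyIntegrable f)
    (h : ∀ i, HasWeakDeriv (EuclideanSpace.single i 1) f (g i))
    (hg : ∀ i, LocallyIntegrable (fun x => |g i x| ^ (2 * n + 1))) :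
    ∃ f' : EuclideanSpace ℝ (Fin n) → ℝ, Continuous f' ∧ f =ᵐ[volume] f' := by
  -- Genuinely measurable versions make the exceptional set in (x, w) measurable, which exchanging
  -- the two null-set quantifiers requires.
  wlog hmeas : Measurable f ∧ ∀ i, Measurable (g i) generalizing f g
  · have hfm := hf.aestronglyMeasurable
    have hgm := fun i => (h i).2.1.aestronglyMeasurable
    obtain ⟨f', hf', hff'⟩ := this (f := hfm.mk f) (g := fun i => (hgm i).mk (g i))
      (hf.congr hfm.ae_eq_mk)
      (fun i => (h i).congr hfm.ae_eq_mk (hgm i).ae_eq_mk)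
      (fun i => (hg i).congr (by filter_upwards [(hgm i).ae_eq_mk] with x hx; rw [hx]))
      ⟨hfm.stronglyMeasurable_mk.measurable, fun i => (hgm i).stronglyMeasurable_mk.measurable⟩
    exact ⟨f', hf', hfm.ae_eq_mk.trans hff'⟩
  obtain ⟨hfm, hgm⟩ := hmeas
  let b : ContDiffBump (0 : EuclideanSpace ℝ (Fin n)) := ⟨1 / 2, 1, by norm_num, by norm_num⟩
  set η : EuclideanSpace ℝ (Fin n) → ℝ := b.normed volume with hη
  have hηc : Continuous η := b.continuous_normed
  have hηs : HasCompactSupport η := b.hasCompactSupport_normed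
  have hη1 : ∫ w, η w = 1 := b.integral_normed
  have hηsupp : ∀ w, w ∉ Metric.ball (0 : EuclideanSpace ℝ (Fin n)) 1 → η w = 0 := fun w hw => by
    have := b.support_normed_eq (μ := volume)
    by_contra h0
    exact hw (this ▸ Function.mem_support.2 h0)
  obtain ⟨C, hC⟩ := hηc.bounded_above_of_compact_support hηs
  set A : EuclideanSpace ℝ (Fin n) → ℝ := fun x => ∑ i, |g i x| with hA
  set B : EuclideanSpace ℝ (Fin n) → ℝ := fun x => ∑ i, |g i x| ^ (2 * n + 1) with hB
  have hAm : Measurable A := by fun_prop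
  have hBm : Measurable B := by fun_prop
  have hBi : LocallyIntegrable B := locallyIntegrable_finsetSum _ fun i _ => hg i
  have hB0 : ∀ x, 0 ≤ B x := fun x => by positivity
  have hAB : ∀ x s, 0 < s → A x ≤ n * s ^ (-(1 / 2) : ℝ) + s ^ n * B x := by
    intro x s hs
    calc A x ≤ ∑ i, (s ^ (-(1 / 2) : ℝ) + s ^ n * |g i x| ^ (2 * n + 1)) :=
          Finset.sum_le_sum fun i _ => le_rpow_add_pow_mul (abs_nonneg _) hs n
      _ = _ := by simp [Finset.sum_add_distrib, Finset.mul_sum, hB]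
  have hr : ∀ k : ℕ, 0 < 1 / ((k : ℝ) + 1) := fun k => by positivity
  have hr1 : ∀ k : ℕ, 1 / ((k : ℝ) + 1) ≤ 1 := fun k => by
    rw [div_le_one (by positivity)]
    linarith [k.cast_nonneg (α := ℝ)]
  refine exists_continuous_ae_eq_of_ae_edist_le
    (h := fun k x => ∫ w, f (x + (1 / ((k : ℝ) + 1)) • w) * η w)
    (fun k => continuous_integral_comp_add_smul_mul hf hηc hηs (hr k)) fun R => ?_
  set V : ℝ≥0∞ := volume (Metric.ball (0 : EuclideanSpace ℝ (Fin n)) 1) with hV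
  set M : ℝ≥0∞ := ∫⁻ y in Metric.ball (0 : EuclideanSpace ℝ (Fin n)) (R + 1),
    ENNReal.ofReal (B y) with hM
  have hVt : V ≠ ∞ := measure_ball_lt_top.ne
  have hMt : M ≠ ∞ := by
    have := (hBi.integrableOn_isCompact (isCompact_closedBall 0 ((R : ℝ) + 1))).mono_set
      Metric.ball_subset_closedBall
    have h2 := this.2
    rw [hasFiniteIntegral_iff_ofReal (Eventually.of_forall hB0)] at h2
    exact h2.ne
  -- Bounds, uniformly for x in the ball of radius R, C times the integral over the unit ball of w ↦
  -- A(x + sw). Integrability on (0, 1] makes its integral over (0, r] tend to 0.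
  set J : ℝ → ℝ≥0∞ := fun s =>
    ENNReal.ofReal C * (ENNReal.ofReal (n * s ^ (-(1 / 2) : ℝ)) * V + M) with hJ
  have hJint : ∫⁻ s in Ioc (0:ℝ) 1, J s ≠ ∞ := by
    have h1 : IntegrableOn (fun s : ℝ => (n : ℝ) * s ^ (-(1 / 2) : ℝ)) (Ioc 0 1) := by
      have := intervalIntegral.intervalIntegrable_rpow' (a := 0) (b := 1) (r := -(1 / 2))
        (by norm_num)
      exact ((intervalIntegrable_iff_integrableOn_Ioc_of_le zero_le_one).1 this).const_mul _
    have h2 : ∫⁻ s in Ioc (0:ℝ) 1, ENNReal.ofReal (n * s ^ (-(1 / 2) : ℝ)) ≠ ∞ :=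
      h1.lintegral_lt_top.ne
    rw [hJ, lintegral_const_mul' _ _ ENNReal.ofReal_ne_top, lintegral_add_right _ measurable_const,
      lintegral_mul_const' _ _ hVt]
    refine ENNReal.mul_ne_top ENNReal.ofReal_ne_top
      (ENNReal.add_ne_top.2 ⟨ENNReal.mul_ne_top h2 hVt, ?_⟩)
    simpa using hMt
  refine ⟨fun k => ∫⁻ s in Ioc 0 (1 / ((k : ℝ) + 1)), J s, ?_, fun k => ?_⟩
  · have h1 : ∀ k : ℕ, ∫⁻ s in Ioc 0 (1 / ((k : ℝ) + 1)), J s =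
        ∫⁻ s in Ioc 0 (1 / ((k : ℝ) + 1)), J s ∂(volume.restrict (Ioc 0 1)) := fun k => by
      rw [Measure.restrict_restrict measurableSet_Ioc,
        inter_eq_left.2 (Ioc_subset_Ioc_right (hr1 k))]
    simp only [h1]
    refine tendsto_setLIntegral_zero hJint ?_
    refine tendsto_of_tendsto_of_tendsto_of_le_of_le tendsto_const_nhds ?_ (fun _ => zero_le)
      (fun k => Measure.restrict_apply_le _ _)
    simp only [Real.volume_Ioc, sub_zero]
    rw [← ENNReal.ofReal_zero]
    exact ENNReal.tendsto_ofReal tendsto_one_div_add_atTop_nhds_zero_nat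
  · set r : ℝ := 1 / ((k : ℝ) + 1)
    have hr := hr k
    have hr1 := hr1 k
    have hmeasI : Measurable (fun p : EuclideanSpace ℝ (Fin n) × EuclideanSpace ℝ (Fin n) =>
        ∫⁻ s in Ioc 0 r, ENNReal.ofReal (A (p.1 + s • p.2))) := by
      refine Measurable.lintegral_prod_right'
        (f := fun q : (EuclideanSpace ℝ (Fin n) × EuclideanSpace ℝ (Fin n)) × ℝ =>
          ENNReal.ofReal (A (q.1.1 + q.2 • q.1.2))) ?_
      exact (hAm.comp (by fun_prop)).ennreal_ofReal
    have hset : MeasurableSet {p : EuclideanSpace ℝ (Fin n) × EuclideanSpace ℝ (Fin n) |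
        p.2 ∈ Metric.ball 0 1 → ‖f (p.1 + r • p.2) - f p.1‖ₑ ≤
          ∫⁻ s in Ioc 0 r, ENNReal.ofReal (A (p.1 + s • p.2))} := by
      refine MeasurableSet.imp (measurableSet_ball.preimage measurable_snd) ?_
      refine measurableSet_le ?_ hmeasI
      exact ((hfm.comp (by fun_prop)).sub (hfm.comp measurable_fst)).enorm
    -- The increment bound holds for each w and almost every x; averaging over w needs it for almost
    -- every x and almost every w.
    have hae := (Measure.ae_ae_comm (μ := volume) (ν := volume)
      (p := fun x w : EuclideanSpace ℝ (Fin n) => w ∈ Metric.ball 0 1 →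
        ‖f (x + r • w) - f x‖ₑ ≤ ∫⁻ s in Ioc 0 r, ENNReal.ofReal (A (x + s • w))) hset).2
      (Eventually.of_forall fun w => by
        by_cases hw : w ∈ Metric.ball (0 : EuclideanSpace ℝ (Fin n)) 1
        · filter_upwards [HasWeakDeriv.ae_enorm_sub_le hf h
            (mem_ball_zero_iff.1 hw).le hr.le] with x hx _ using hx
        · exact Eventually.of_forall fun x hw' => absurd hw' hw)
    filter_upwards [hae] with x hx hxR
    have hsub : (∫ w, f (x + r • w) * η w) - f x = ∫ w, (f (x + r • w) - f x) * η w := by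
      simp only [sub_mul]
      rw [integral_sub (integrable_comp_add_smul_mul hf hηc hηs hr x)
        ((hηc.integrable_of_hasCompactSupport hηs).const_mul _), integral_const_mul, hη1, mul_one]
    rw [edist_eq_enorm_sub, hsub]
    calc ‖∫ w, (f (x + r • w) - f x) * η w‖ₑ
      _ ≤ ∫⁻ w, ‖(f (x + r • w) - f x) * η w‖ₑ := enorm_integral_le_lintegral_enorm _
      _ ≤ ∫⁻ w in Metric.ball 0 1, ENNReal.ofReal C *
          ∫⁻ s in Ioc 0 r, ENNReal.ofReal (A (x + s • w)) := by
        rw [← lintegral_indicator measurableSet_ball]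
        refine lintegral_mono_ae ?_
        filter_upwards [hx] with w hw
        by_cases hwb : w ∈ Metric.ball (0 : EuclideanSpace ℝ (Fin n)) 1
        · rw [indicator_of_mem hwb, enorm_mul, mul_comm]
          refine mul_le_mul' ?_ (hw hwb)
          rw [← ofReal_norm]
          exact ENNReal.ofReal_le_ofReal (hC w)
        · simp [hηsupp w hwb]
      _ = ∫⁻ s in Ioc 0 r, ENNReal.ofReal C *
          ∫⁻ w in Metric.ball 0 1, ENNReal.ofReal (A (x + s • w)) := by
        rw [lintegral_const_mul' _ _ ENNReal.ofReal_ne_top,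
          lintegral_const_mul' _ _ ENNReal.ofReal_ne_top, lintegral_lintegral_swap]
        exact (hAm.comp (by fun_prop)).ennreal_ofReal.aemeasurable
      _ ≤ ∫⁻ s in Ioc 0 r, J s := by
        refine setLIntegral_mono' measurableSet_Ioc fun s hs => ?_
        rw [hJ]
        refine mul_le_mul_right ?_ _
        -- After splitting A, the factor s^n pays for the substitution y = x + sw, and the integral
        -- of B over the ball of radius R + 1 no longer involves x or s.
        calc ∫⁻ w in Metric.ball 0 1, ENNReal.ofReal (A (x + s • w))
          _ ≤ ∫⁻ w in Metric.ball 0 1, (ENNReal.ofReal (n * s ^ (-(1 / 2) : ℝ)) +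
              ENNReal.ofReal (s ^ n) * ENNReal.ofReal (B (x + s • w))) := by
            refine lintegral_mono fun w => ?_
            rw [← ENNReal.ofReal_mul (pow_nonneg hs.1.le n)]
            exact (ENNReal.ofReal_le_ofReal (hAB _ s hs.1)).trans ENNReal.ofReal_add_le
          _ = ENNReal.ofReal (n * s ^ (-(1 / 2) : ℝ)) * V + ENNReal.ofReal (s ^ n) *
              ∫⁻ w in Metric.ball 0 1, ENNReal.ofReal (B (x + s • w)) := by
            rw [lintegral_add_left measurable_const, setLIntegral_const,
              lintegral_const_mul' _ _ ENNReal.ofReal_ne_top]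
          _ ≤ _ := by
            gcongr
            have := mul_lintegral_ball_comp_add_smul_le (F := fun y => ENNReal.ofReal (B y))
              hBm.ennreal_ofReal hs.1 (hs.2.trans hr1) hxR
            rwa [finrank_euclideanSpace_fin] at this

theorem exists_continuous_ae_eq_of_mem_orliczSobolev {f : EuclideanSpace ℝ (Fin n) → ℝ}
    (hf : f ∈ orliczSobolev n) :
    ∃ f' : EuclideanSpace ℝ (Fin n) → ℝ, Continuous f' ∧ f =ᵐ[gaussian n] f' := by
  choose g hg hgo using hf.2
  obtain ⟨f', hf', hff'⟩ := exists_continuous_ae_eq_of_hasWeakDeriv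
    (hf.1.locallyIntegrable one_ne_zero) (fun i => isWeakPartialDeriv_iff.1 (hg i))
    fun i => locallyIntegrable_gaussian_iff.1
      ((hgo i).integrable_abs_pow two_ne_zero _).locallyIntegrable
  exact ⟨f', hf', ae_gaussian_iff.2 hff'⟩

end Euclidean

/-! ### Polynomials of degree at most two -/

section Polynomial

variable {n : ℕ}

theorem memOrliczPow_one_add_norm {k d : ℕ} (hk : k ≠ 0) (hd : d * k = 2) :
    MemOrliczPow cosh₂ k (gaussian n) (fun x => (1 + ‖x‖) ^ d) := by
  rw [memOrliczPow_cosh₂_iff hk]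
  -- With c = 1/8, (1 + |x|)²/8 ≤ 1/4 + |x|²/4, so exp(−|x|²/2) still leaves exp(−|x|²/4).
  refine ⟨(by fun_prop : Continuous fun x : EuclideanSpace ℝ (Fin n) =>
    (1 + ‖x‖) ^ d).aestronglyMeasurable, 1 / 8, by norm_num, ?_⟩
  have hi : Integrable (fun x : EuclideanSpace ℝ (Fin n) => Real.exp (-(1 / 4) * ‖x‖ ^ 2)) := by
    -- The integral of a non-integrable function is 0 by convention, whereas this one has a known
    -- positive value.
    refine not_imp_comm.1 integral_undef ?_
    rw [GaussianFourier.integral_rexp_neg_mul_sq_norm (by norm_num)]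
    have := Real.pi_pos
    positivity
  have hi2 := (hi.const_mul ((√(2 * Real.pi))⁻¹ ^ n * Real.exp (1 / 4))).lintegral_lt_top
  have hm : Measurable (fun x : EuclideanSpace ℝ (Fin n) =>
      ENNReal.ofReal (Real.exp (1 / 8 * |(1 + ‖x‖) ^ d| ^ k))) := by fun_prop
  rw [gaussian_eq, lintegral_withDensity_eq_lintegral_mul _
    continuous_gaussDensity.measurable.ennreal_ofReal hm]
  refine (lintegral_mono fun x => ?_).trans_lt hi2
  rw [Pi.mul_apply, ← ENNReal.ofReal_mul (gaussDensity_pos x).le]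
  refine ENNReal.ofReal_le_ofReal ?_
  rw [abs_of_nonneg (by positivity), ← pow_mul, hd, gaussDensity, mul_assoc, mul_assoc,
    ← Real.exp_add, ← Real.exp_add]
  refine mul_le_mul_of_nonneg_left (Real.exp_le_exp.2 ?_) (by positivity)
  nlinarith [sq_nonneg (‖x‖ - 1)]

theorem abs_eval_le (p : MvPolynomial (Fin n) ℝ) {d : ℕ} (hp : p.totalDegree ≤ d)
    (x : EuclideanSpace ℝ (Fin n)) :
    |MvPolynomial.eval (fun i => x i) p| ≤ (∑ m ∈ p.support, |p.coeff m|) * (1 + ‖x‖) ^ d := by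
  rw [MvPolynomial.eval_eq', Finset.sum_mul]
  refine (Finset.abs_sum_le_sum_abs _ _).trans (Finset.sum_le_sum fun m hm => ?_)
  rw [abs_mul, Finset.abs_prod]
  refine mul_le_mul_of_nonneg_left ?_ (abs_nonneg _)
  have h1 : (1 : ℝ) ≤ 1 + ‖x‖ := by linarith [norm_nonneg x]
  have hmd : ∑ i, m i ≤ d := by
    have := MvPolynomial.le_totalDegree hm
    rw [Finsupp.sum_fintype _ _ (fun _ => rfl)] at this
    exact this.trans hp
  calc ∏ i, |x i ^ m i| ≤ ∏ i, (1 + ‖x‖) ^ m i := by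
        refine Finset.prod_le_prod (fun i _ => abs_nonneg _) fun i _ => ?_
        rw [abs_pow]
        refine pow_le_pow_left₀ (abs_nonneg _) ?_ _
        have : |x i| ≤ ‖x‖ := PiLp.norm_apply_le x i
        linarith
    _ = (1 + ‖x‖) ^ ∑ i, m i := Finset.prod_pow_eq_pow_sum _ _ _
    _ ≤ (1 + ‖x‖) ^ d := pow_le_pow_right₀ h1 hmd

theorem totalDegree_pderiv_le (p : MvPolynomial (Fin n) ℝ) (i : Fin n) {d : ℕ}
    (hp : p.totalDegree ≤ d + 1) : (MvPolynomial.pderiv i p).totalDegree ≤ d := by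
  refine Finset.sup_le fun m hm => ?_
  rw [MvPolynomial.mem_support_iff, MvPolynomial.coeff_pderiv] at hm
  have h := MvPolynomial.le_totalDegree (MvPolynomial.mem_support_iff.2 (left_ne_zero_of_mul hm))
  rw [Finsupp.sum_add_index' (fun _ => rfl) (fun _ _ _ => rfl),
    Finsupp.sum_single_index rfl] at h
  omega

theorem contDiff_eval (p : MvPolynomial (Fin n) ℝ) :
    ContDiff ℝ 1 (fun x : EuclideanSpace ℝ (Fin n) => MvPolynomial.eval (fun i => x i) p) := by
  induction p using MvPolynomial.induction_on with
  | C a => simpa using contDiff_const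
  | add p q hp hq => simpa using hp.add hq
  | mul_X p i hp =>
    simp only [map_mul, MvPolynomial.eval_X]
    exact hp.mul (by fun_prop)

theorem fderiv_eval (p : MvPolynomial (Fin n) ℝ) (i : Fin n) (x : EuclideanSpace ℝ (Fin n)) :
    fderiv ℝ (fun x : EuclideanSpace ℝ (Fin n) => MvPolynomial.eval (fun i => x i) p) x
      (EuclideanSpace.single i 1) = MvPolynomial.eval (fun i => x i) (MvPolynomial.pderiv i p) := by
  have hd := fun p : MvPolynomial (Fin n) ℝ => (contDiff_eval p).differentiable one_ne_zero x
  induction p using MvPolynomial.induction_on with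
  | C a => simp
  | add p q hp hq =>
    simp only [map_add]
    rw [fderiv_fun_add (hd p) (hd q)]
    simp [hp, hq]
  | mul_X p j hp =>
    have hj : HasFDerivAt (fun x : EuclideanSpace ℝ (Fin n) => x j)
        (EuclideanSpace.proj j : EuclideanSpace ℝ (Fin n) →L[ℝ] ℝ) x :=
      (EuclideanSpace.proj j : EuclideanSpace ℝ (Fin n) →L[ℝ] ℝ).hasFDerivAt
    simp only [map_mul, MvPolynomial.eval_X]
    rw [fderiv_fun_mul (hd p) hj.differentiableAt, hj.fderiv, MvPolynomial.pderiv_mul,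
      MvPolynomial.pderiv_X]
    rcases eq_or_ne j i with rfl | hij
    · simp [hp]
      ring
    · simp [hp, hij, mul_comm]

theorem hasWeakDeriv_of_contDiff {E : Type*} [NormedAddCommGroup E] [InnerProductSpace ℝ E]
    [FiniteDimensional ℝ E] [MeasurableSpace E] [BorelSpace E] {f : E → ℝ} (hf : ContDiff ℝ 1 f)
    (e : E) : HasWeakDeriv e f (fun x => fderiv ℝ f x e) := by
  have hf' : Continuous (fun x => fderiv ℝ f x e) :=
    (hf.continuous_fderiv one_ne_zero).clm_apply continuous_const
  refine ⟨hf.continuous.locallyIntegrable, hf'.locallyIntegrable, fun ψ hψ hc => ?_⟩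
  rw [integral_mul_fderiv_eq_neg_fderiv_mul_of_integrable, neg_neg]
  · exact integrable_mul_of_hasCompactSupport hf'.locallyIntegrable hψ.continuous hc
  · exact integrable_mul_of_hasCompactSupport hf.continuous.locallyIntegrable
      ((hψ.continuous_fderiv one_ne_zero).clm_apply continuous_const) (hc.fderiv_apply ℝ e)
  · exact integrable_mul_of_hasCompactSupport hf.continuous.locallyIntegrable hψ.continuous hc
  · exact fun x _ => hf.differentiable one_ne_zero x
  · exact fun x _ => hψ.differentiable one_ne_zero x

/-- The relation d * k = 2 matches quadratic growth in the exponent: degree 2 with k = 1 for the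
polynomial, degree 1 with k = 2 for its derivatives. -/
theorem memOrliczPow_eval (p : MvPolynomial (Fin n) ℝ) {k d : ℕ} (hk : k ≠ 0) (hd : d * k = 2)
    (hp : p.totalDegree ≤ d) : MemOrliczPow cosh₂ k (gaussian n)
      (fun x : EuclideanSpace ℝ (Fin n) => MvPolynomial.eval (fun i => x i) p) := by
  have hK : 0 ≤ ∑ m ∈ p.support, |p.coeff m| := Finset.sum_nonneg fun _ _ => abs_nonneg _
  have hb := memOrliczPow_one_add_norm (n := n) hk hd
  refine MemOrliczPow.of_abs_le hk le_rfl hK hb hb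
    (contDiff_eval p).continuous.aestronglyMeasurable (Eventually.of_forall fun x => ?_)
  have h := abs_eval_le p hp x
  have h0 : 0 ≤ (∑ m ∈ p.support, |p.coeff m|) * (1 + ‖x‖) ^ d := by positivity
  rw [abs_of_nonneg (by positivity : 0 ≤ (1 + ‖x‖) ^ d)]
  linarith

theorem eval_mem_orliczSobolev (p : MvPolynomial (Fin n) ℝ) (hp : p.totalDegree ≤ 2) :
    (fun x : EuclideanSpace ℝ (Fin n) => MvPolynomial.eval (fun i => x i) p) ∈ orliczSobolev n := by
  refine ⟨memOrliczPow_eval p one_ne_zero rfl hp, fun i => ⟨_, isWeakPartialDeriv_iff.2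
    (hasWeakDeriv_of_contDiff (contDiff_eval p) _), ?_⟩⟩
  simp only [fderiv_eval]
  exact memOrliczPow_eval _ two_ne_zero rfl (totalDegree_pderiv_le p i hp)

end Polynomial

end GaussianOrlicz

theorem mainTheorem4 (n : ℕ) :
    (∀ p : MvPolynomial (Fin n) ℝ, p.totalDegree ≤ 2 →
      (fun x : EuclideanSpace ℝ (Fin n) => MvPolynomial.eval (fun i => x i) p)
        ∈ GaussianOrlicz.orliczSobolev n) ∧
    (∀ f ∈ GaussianOrlicz.orliczSobolev n,
      ∃ f' : EuclideanSpace ℝ (Fin n) → ℝ,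
        Continuous f' ∧ f =ᵐ[GaussianOrlicz.gaussian n] f') ∧
    (∀ G g : ℝ → ℝ, GaussianOrlicz.IsPrimitive G g → (∃ K : ℝ, ∀ t, |g t| ≤ K) →
      ∀ f ∈ GaussianOrlicz.orliczSobolev n,
        (fun x => G (f x)) ∈ GaussianOrlicz.orliczSobolev n) ∧
    (∀ f ∈ GaussianOrlicz.orliczSobolev n, ∀ g ∈ GaussianOrlicz.orliczSobolev n,
      (fun x => min (f x) (g x)) ∈ GaussianOrlicz.orliczSobolev n ∧
      (fun x => max (f x) (g x)) ∈ GaussianOrlicz.orliczSobolev n) := by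
  open GaussianOrlicz in
  exact ⟨eval_mem_orliczSobolev, fun _ => exists_continuous_ae_eq_of_mem_orliczSobolev,
    fun _ _ hG hg _ hf => primitive_comp_mem_orliczSobolev hG hg hf,
    fun _ hf _ hg => ⟨min_mem_orliczSobolev hf hg, max_mem_orliczSobolev hf hg⟩⟩
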